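/- Let $r\ge 1$ and $\ell=2r+1$, and write $[x,y]=xyx^{-1}y^{-1}$. Let $F$ be the free group on $z,\ u_1,\dots,u_r,\ a,\ b,\ b_0,\dots,b_{2r},\ w$. Let $c\ge 0$ be the smallest integer with $2c\equiv r^2+\tfrac{r(r+1)}{2} \pmod{\ell}$. For each non-empty subset $I\subset\{1,\dots,r\}$ and $0\le t\le 2r$ let $c_t(I)\in\mathbb Z$ be the coefficients in $\prod_{i\in I}(1-X^i)\equiv\sum_{t=0}^{2r}c_t(I)X^t \pmod{X^{\ell}-1}$, and put $$c(I)=\Big(\prod_{t=0}^{2r}b_t^{\,c_t(I)}\Big)a^{-1}\prod_{i\in I}u_i$$ (products in increasing order of the index). Let $K$ be the normal closure in $F$ of the relators $xy^{-1}$ associated with the following relations $x=y$, where $i,j\in\{1,\dots,r\}$, $s,t\in\{0,\dots,2r\}$ and $I$ runs over the non-empty subsets of $\{1,\dots,r\}$: $$b_t=z^{rt}bz^{rt}a,\qquad w=z^cu_1u_2\cdots u_r,$$ $$z^\ell=[z,u_i]=[u_i,u_j]=1,\qquad a^4=[a^2,z]=[a^2,u_i]=1,\qquad a=zaz=u_iau_i,$$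 $$[b_s,b_t]=1,\qquad b^3=a^2=b_0b_1\cdots b_{2r},\qquad b_t^\ell=w^{-1}b_t^{(-1)^r}w,\qquad c(I)^3=1,$$ $$ba^2=u_ibz^{-ri}b^{-1}b_0^{-1}z^{ri}bz^{-i}u_i .$$ Let $[F,K]$ be the subgroup generated by the commutators $[x,y]$ with $x\in F$, $y\in K$, let $[F,F]$ be the commutator subgroup of $F$, and let $K^\ell$ be the normal closure in $F$ of the $\ell$-th powers of these relators. If $\ell\in\{3,5\}$, then $[e_1,e_2]\in[F,K]K^\ell$ for all $e_1,e_2\in\{z,u_1,\dots,u_r\}$. Moreover, for $\ell=5$, $[F,F]\cap K\subset[F,K]K^5$. -/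

import Mathlib

open scoped commutatorElement

namespace SE2

/-- The generators `z`, `u₁, …, u_r`, `a`, `b`, `b₀, …, b_{2r}`, `w`.
The symbol `u i` with `i : Fin r` stands for `u_{i+1}`, since `Fin r` starts at `0`. -/
inductive Gen (r : ℕ) : Type
  | z : Gen r
  | u (i : Fin r) : Gen r
  | a : Gen r
  | b : Gen r
  | bt (t : Fin (2 * r + 1)) : Gen r
  | w : Gen r

/-- The free group on these generators. -/
abbrev F (r : ℕ) : Type := FreeGroup (Gen r)

def z {r : ℕ} : F r := FreeGroup.of Gen.z
def u {r : ℕ} (i : Fin r) : F r := FreeGroup.of (Gen.u i)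
def a {r : ℕ} : F r := FreeGroup.of Gen.a
def b {r : ℕ} : F r := FreeGroup.of Gen.b
def bt {r : ℕ} (t : Fin (2 * r + 1)) : F r := FreeGroup.of (Gen.bt t)
def w {r : ℕ} : F r := FreeGroup.of Gen.w

theorem exists_cexp (r : ℕ) :
    ∃ c : ℕ, 2 * c ≡ r ^ 2 + r * (r + 1) / 2 [MOD 2 * r + 1] := by
  refine ⟨(r + 1) * (r ^ 2 + r * (r + 1) / 2), ?_⟩
  generalize r ^ 2 + r * (r + 1) / 2 = m
  have h : 2 * ((r + 1) * m) = m + (2 * r + 1) * m := by ring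
  rw [h]
  exact (Nat.modEq_iff_dvd' (Nat.le_add_right _ _)).2 (by simp) |>.symm

/-- The smallest `c ≥ 0` with `2c ≡ r² + r(r+1)/2` modulo `2r+1`. -/
def cexp (r : ℕ) : ℕ := Nat.find (exists_cexp r)

/-- The sum of a set of indices; the element `i : Fin r` is the index `i + 1`. -/
def indexSum {r : ℕ} (J : Finset (Fin r)) : ℕ := ∑ i ∈ J, ((i : ℕ) + 1)

/-- The coefficient `c_t(I)` of `X^t` in the expansion of `∏_{i ∈ I} (1 - X^i)` modulo
`X^{2r+1} - 1`. -/
def coeffI {r : ℕ} (I : Finset (Fin r)) (t : Fin (2 * r + 1)) : ℤ :=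
  ∑ J ∈ I.powerset with indexSum J % (2 * r + 1) = (t : ℕ), (-1) ^ J.card

/-- The identity `∏_{i ∈ I} (1 - ξ^i) = ∑_t c_t(I) ξ^t` for `ξ^{2r+1} = 1`. -/
theorem prod_one_sub_eq {R : Type*} [CommRing R] {r : ℕ} (ξ : R) (hξ : ξ ^ (2 * r + 1) = 1)
    (I : Finset (Fin r)) :
    ∏ i ∈ I, (1 - ξ ^ ((i : ℕ) + 1)) =
      ∑ t : Fin (2 * r + 1), (coeffI I t : R) * ξ ^ (t : ℕ) := by
  have h1 : ∏ i ∈ I, (1 - ξ ^ ((i : ℕ) + 1)) =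
      ∑ J ∈ I.powerset, (-1 : R) ^ J.card * ξ ^ (indexSum J % (2 * r + 1)) := by
    simp only [sub_eq_add_neg]
    rw [Finset.prod_one_add]
    refine Finset.sum_congr rfl fun J _ => ?_
    rw [← pow_eq_pow_mod _ hξ, Finset.prod_neg, indexSum, Finset.prod_pow_eq_pow_sum]
  rw [h1]
  simp only [coeffI, Finset.sum_filter, Int.cast_sum, Finset.sum_mul]
  rw [Finset.sum_comm]
  refine Finset.sum_congr rfl fun J _ => ?_
  have hlt : indexSum J % (2 * r + 1) < 2 * r + 1 := Nat.mod_lt _ (by omega)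
  rw [Finset.sum_eq_single (⟨indexSum J % (2 * r + 1), hlt⟩ : Fin (2 * r + 1))]
  · simp
  · intro t _ ht
    have h : indexSum J % (2 * r + 1) ≠ (t : ℕ) := fun h => ht (Fin.ext h.symm)
    simp [h]
  · simp

/-- The word `c(I) = (∏_{t=0}^{2r} b_t^{c_t(I)}) a⁻¹ ∏_{i ∈ I} u_i`, both products being taken in
increasing order of the index. -/
def cword {r : ℕ} (I : Finset (Fin r)) : F r :=
  ((List.finRange (2 * r + 1)).map fun t => bt t ^ coeffI I t).prod * a⁻¹ *
    (((List.finRange r).filter fun i => i ∈ I).map fun i => u i).prod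

/-- The defining relations; `DefRel r x y` means that `x = y` is one of them. -/
inductive DefRel (r : ℕ) : F r → F r → Prop
  | bt_def (t : Fin (2 * r + 1)) :
      DefRel r (bt t) (z ^ (r * (t : ℕ)) * b * z ^ (r * (t : ℕ)) * a)
  | w_def : DefRel r w (z ^ cexp r * ((List.finRange r).map fun i => u i).prod)
  | z_pow : DefRel r (z ^ (2 * r + 1)) 1
  | z_u (i : Fin r) : DefRel r ⁅(z : F r), u i⁆ 1
  | u_u (i j : Fin r) : DefRel r ⁅u i, u j⁆ 1
  | a_pow : DefRel r (a ^ 4) 1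
  | a_z : DefRel r ⁅(a : F r) ^ 2, (z : F r)⁆ 1
  | a_u (i : Fin r) : DefRel r ⁅(a : F r) ^ 2, u i⁆ 1
  | z_a_z : DefRel r a (z * a * z)
  | u_a_u (i : Fin r) : DefRel r a (u i * a * u i)
  | b_b (s t : Fin (2 * r + 1)) : DefRel r ⁅bt s, bt t⁆ 1
  | b_cube : DefRel r (b ^ 3) (a ^ 2)
  | b_prod : DefRel r (a ^ 2) ((List.finRange (2 * r + 1)).map fun t => bt t).prod
  | b_pow (t : Fin (2 * r + 1)) :
      DefRel r (bt t ^ (2 * r + 1)) (w⁻¹ * bt t ^ ((-1 : ℤ) ^ r) * w)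
  | c_cube (I : Finset (Fin r)) (hI : I.Nonempty) : DefRel r (cword I ^ 3) 1
  | last (i : Fin r) :
      DefRel r (b * a ^ 2)
        (u i * b * (z ^ (r * ((i : ℕ) + 1)))⁻¹ * b⁻¹ * (bt 0)⁻¹ * z ^ (r * ((i : ℕ) + 1)) * b *
          (z ^ ((i : ℕ) + 1))⁻¹ * u i)

/-- The relators `x y⁻¹` associated with the relations `x = y`. -/
def relators (r : ℕ) : Set (F r) := {g | ∃ x y, DefRel r x y ∧ g = x * y⁻¹}

/-- The normal subgroup `K` of `F` given by the relators. -/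
def K (r : ℕ) : Subgroup (F r) := Subgroup.normalClosure (relators r)

/-- The normal subgroup `K^n` of `F` given by the `n`-th powers of the relators. -/
def Kpow (r n : ℕ) : Subgroup (F r) := Subgroup.normalClosure ((fun g => g ^ n) '' relators r)

/-- The subgroup `[F,K] K^n` of `F`. Both factors are normal, so it is their join. -/
def FKKpow (r n : ℕ) : Subgroup (F r) := ⁅(⊤ : Subgroup (F r)), K r⁆ ⊔ Kpow r n

end SE2

-- Let `E = F/[F,K]K^ℓ` and let `A` be the image of `K`, a central subgroup of odd exponent dividing
-- `ℓ`. The projection `F → E` satisfies the relations up to `A`. Multiplying the images of the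
-- generators by elements of `A` does not change the images of commutators, so the projection may be
-- replaced by a corrected homomorphism `f`.
--
-- Square roots in `A` make `a^4 = 1` and the inversion of `z` and `u_i` by `a` exact. The
-- conjugates of `b a⁻¹` by powers of `z` then commute, and the last relation says that `u_i⁻¹` acts
-- on `b a⁻¹` like multiplication by `(1-ζ^i)²`. Its error in `A` is the same for all `i`
-- (`defect_eq`) and is absorbed into `b`. As `z` and `u_i` commute modulo the centre, they generate
-- a commutative ring `S` of operators (`exists_ring_of_conj_commute`). The result is a picture as
-- in `SL₂(S)`: unipotents `x(s)`, torus elements `z` and `u_i`, and units `ζ` and `1-ζ^i`.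
--
-- The cube relations evaluate Steinberg words: `wt v = t a⁻¹`, with `t` explicit up to a constant
-- in `A`, for `v = 1` and, once the `u_i` involved commute, for products of the `1-ζ^i`. If such
-- units satisfy `p + q = r`, then `x(r) = x(p) x(q)` gives a formula for `wt (-pq/r)`
-- (`Lift.wt_of_add`), and its symmetry in `p`, `q` forces commutation. The sum `1 + (-ζ^i) = 1-ζ^i`
-- makes `u_i` commute with `z^i`, which settles `ℓ = 3`. For `ℓ = 5` one more identity makes `u₁`
-- and `u₂` commute.
--
-- For `ℓ = 5`, two further sums kill the constants (`lift_const_eq_one`). Then `f` satisfies every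
-- relation, so it kills `K`; as it agrees with the projection on `[F,F]`, the image of `[F,F] ∩ K`
-- in `E` is trivial.

universe v

/-! ### Unipotents, torus elements and Steinberg words. -/

/-- Upper unipotents `x s` together with a Weyl element `a`, as in `SL₂`. -/
structure WeylSystem (E S : Type*) [Group E] [CommRing S] where
  x : S → E
  x_add : ∀ s t, x (s + t) = x s * x t
  a : E
  a_pow : a ^ 4 = 1
  a_sq : a ^ 2 ∈ Subgroup.center E

namespace WeylSystem

variable {E S : Type*} [Group E] [CommRing S] (W : WeylSystem E S)

theorem x_zero : W.x 0 = 1 := by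
  have h := W.x_add 0 0
  simpa using h

theorem x_neg (s : S) : W.x (-s) = (W.x s)⁻¹ := by
  rw [eq_inv_iff_mul_eq_one, ← W.x_add, neg_add_cancel, x_zero]

/-- `x` as a homomorphism. -/
def xHom : Multiplicative S →* E where
  toFun s := W.x s.toAdd
  map_one' := W.x_zero
  map_mul' s t := W.x_add s.toAdd t.toAdd

theorem x_zsmul (n : ℤ) (s : S) : W.x (n * s) = W.x s ^ n := by
  have := map_zpow W.xHom (Multiplicative.ofAdd s) n
  rw [← zsmul_eq_mul]
  exact this

theorem a_sq_comm (g : E) : W.a * (W.a * g) = g * (W.a * W.a) := by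
  have h := Subgroup.mem_center_iff.1 W.a_sq g
  rw [pow_two] at h
  rw [h, mul_assoc]

theorem a_inv_conj (g : E) : W.a⁻¹ * g * W.a = W.a * g * W.a⁻¹ := by
  have h := W.a_sq_comm g
  calc W.a⁻¹ * g * W.a = W.a⁻¹ * (g * (W.a * W.a)) * W.a⁻¹ := by group
    _ = _ := by rw [← h]; group

/-- Lower unipotents. -/
def y (s : S) : E := W.a * W.x (-s) * W.a⁻¹

theorem y_add (s t : S) : W.y (s + t) = W.y s * W.y t := by
  simp only [y, neg_add, W.x_add]; group

theorem y_zero : W.y 0 = 1 := by simp [y, W.x_zero]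

theorem y_neg (s : S) : W.y (-s) = (W.y s)⁻¹ := by
  rw [eq_inv_iff_mul_eq_one, ← W.y_add, neg_add_cancel, y_zero]

/-- `t` scales the upper unipotents by `k` and the lower ones by `k⁻¹`. -/
structure Scales (t : E) (k : Sˣ) : Prop where
  conj_x : ∀ s, t * W.x s * t⁻¹ = W.x (k * s)
  conj_y : ∀ s, t * W.y s * t⁻¹ = W.y ((k⁻¹ : Sˣ) * s)

variable {W}

theorem Scales.mul {t t' : E} {k k' : Sˣ} (h : W.Scales t k) (h' : W.Scales t' k') :
    W.Scales (t * t') (k * k') where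
  conj_x s := by
    rw [Units.val_mul, mul_assoc (k : S), ← h.conj_x, ← h'.conj_x]; group
  conj_y s := by
    rw [mul_inv, Units.val_mul, mul_assoc ((k⁻¹ : Sˣ) : S), ← h.conj_y, ← h'.conj_y]; group

theorem Scales.inv {t : E} {k : Sˣ} (h : W.Scales t k) : W.Scales t⁻¹ k⁻¹ where
  conj_x s := by
    have := h.conj_x ((k⁻¹ : Sˣ) * s)
    rw [Units.mul_inv_cancel_left] at this
    rw [← this]; group
  conj_y s := by
    have := h.conj_y ((k : Sˣ) * s)
    rw [Units.inv_mul_cancel_left] at this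
    rw [inv_inv, ← this]; group

theorem Scales.of_mem_center {t : E} (h : t ∈ Subgroup.center E) : W.Scales t 1 where
  conj_x s := by
    rw [← Subgroup.mem_center_iff.1 h]; simp
  conj_y s := by
    rw [← Subgroup.mem_center_iff.1 h]; simp

theorem Scales.conj_a {t : E} {k : Sˣ} (h : W.Scales t k) :
    W.Scales (W.a⁻¹ * t * W.a) k⁻¹ where
  conj_x s := by
    have := h.conj_y (-s)
    simp only [y, mul_neg, neg_neg] at this
    have h2 : W.a⁻¹ * t * W.a * W.x s * (W.a⁻¹ * t * W.a)⁻¹ =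
      W.a⁻¹ * (t * (W.a * W.x s * W.a⁻¹) * t⁻¹) * W.a := by group
    rw [h2, this]; group
  conj_y s := by
    have := h.conj_x (-s)
    have h2 : W.a⁻¹ * t * W.a * W.y s * (W.a⁻¹ * t * W.a)⁻¹ =
      W.a⁻¹ * (t * (W.a * (W.a * W.x (-s) * W.a⁻¹) * W.a⁻¹) * t⁻¹) * W.a := by
      simp only [y]; group
    rw [h2, ← W.a_inv_conj (W.a * W.x (-s) * W.a⁻¹)]
    have h3 : t * (W.a⁻¹ * (W.a * W.x (-s) * W.a⁻¹) * W.a) * t⁻¹ = t * W.x (-s) * t⁻¹ := by group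
    rw [h3, this, a_inv_conj, y]; simp

/-- An element inverted by `a` which scales the upper unipotents by `k`. -/
structure Torus (W : WeylSystem E S) (t : E) (k : Sˣ) : Prop where
  conj_x : ∀ s, t * W.x s * t⁻¹ = W.x (k * s)
  inverted : t * W.a * t = W.a

theorem Torus.inv {t : E} {k : Sˣ} (h : W.Torus t k) : W.Torus t⁻¹ k⁻¹ where
  conj_x s := by
    have := h.conj_x ((k⁻¹ : Sˣ) * s)
    rw [Units.mul_inv_cancel_left] at this
    rw [← this]; group
  inverted := by
    nth_rw 1 [← h.inverted]; group

theorem Torus.a_conj {t : E} {k : Sˣ} (h : W.Torus t k) : W.a⁻¹ * t * W.a = t⁻¹ := by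
  have := h.inverted
  rw [mul_assoc, inv_mul_eq_iff_eq_mul, eq_mul_inv_iff_mul_eq, this]

theorem Torus.scales {t : E} {k : Sˣ} (h : W.Torus t k) : W.Scales t k where
  conj_x := h.conj_x
  conj_y s := by
    have h1 := h.inv.conj_x (-s)
    have h2 : t * W.a = W.a * t⁻¹ := by rw [eq_mul_inv_iff_mul_eq, h.inverted]
    calc t * W.y s * t⁻¹ = (t * W.a) * W.x (-s) * (t * W.a)⁻¹ := by simp only [y]; group
      _ = W.a * (t⁻¹ * W.x (-s) * t⁻¹⁻¹) * W.a⁻¹ := by rw [h2]; group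
      _ = _ := by rw [h1, y]; simp

variable (W)

/-- The Steinberg word `x(v) y(-v⁻¹) x(v)`. -/
def wt (v : Sˣ) : E := W.x v * W.y (-(v⁻¹ : Sˣ)) * W.x v

/-- `t a⁻¹` is the Steinberg word of the unit `v`. -/
structure Lift (v : Sˣ) (t : E) : Prop where
  wt_eq : W.wt v = t * W.a⁻¹
  scales : W.Scales t (v ^ 2)

variable {W}

theorem Lift.congr {v v' : Sˣ} {t t' : E} (h : W.Lift v t) (hv : v = v') (ht : t = t') :
    W.Lift v' t' := by subst hv ht; exact h

/-- Moving the factors `h` and `a⁻¹` through the cube turns its middle `x(v)` into `y(-v⁻¹)`, so the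
cube equals `wt v * a * h`. -/
theorem Lift.of_cube {h c : E} {v : Sˣ} (hh : W.Torus h (v⁻¹ ^ 2))
    (hc : c ∈ Subgroup.center E) (hcube : (W.x v * W.a⁻¹ * h) ^ 3 = c) :
    W.Lift v (c * h⁻¹) where
  wt_eq := by
    have h1 : W.a⁻¹ * (h * W.x v * h⁻¹) * W.a = W.y (-(v⁻¹ : Sˣ)) := by
      rw [a_inv_conj, hh.conj_x, y, neg_neg]; congr 3
      rw [pow_two, Units.val_mul, mul_assoc]; simp
    have h2 : h * W.a⁻¹ * h = W.a⁻¹ := by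
      have := congrArg (·⁻¹) hh.inv.inverted
      simpa [mul_assoc] using this
    have h3 : W.a⁻¹ * W.a⁻¹ * W.a⁻¹ = W.a := by
      rw [← mul_left_inj (W.a ^ 3)]
      have : W.a * W.a ^ 3 = 1 := by rw [← pow_succ', W.a_pow]
      rw [this]; group
    have h4 : (W.x v * W.a⁻¹ * h) ^ 3 = W.wt v * W.a * h := by
      calc (W.x v * W.a⁻¹ * h) ^ 3 = W.x v * (W.a⁻¹ * (h * W.x v * h⁻¹) * W.a) * W.a⁻¹ *
            (h * W.a⁻¹ * h) * W.x v * W.a⁻¹ * h := by simp only [pow_succ, pow_zero]; group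
        _ = W.x v * W.y (-(v⁻¹ : Sˣ)) * (W.a⁻¹ * (W.a⁻¹ * W.x v * W.a) * W.a) *
            (W.a⁻¹ * W.a⁻¹ * W.a⁻¹) * h := by rw [h1, h2]; group
        _ = _ := by
          rw [h3, a_inv_conj W (W.x v), wt]; group
    rw [← hcube, h4]; group
  scales := by
    have := (Scales.of_mem_center (W := W) hc).mul hh.inv.scales
    simpa using this

theorem Lift.conj {v k : Sˣ} {t g : E} (h : W.Lift v t) (hg : W.Torus g (k ^ 2)) :
    W.Lift (k ^ 2 * v) (g * t * g) where
  wt_eq := by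
    have h1 : g * W.wt v * g⁻¹ = W.wt (k ^ 2 * v) := by
      have e1 : W.x ((k ^ 2 * v : Sˣ) : S) = g * W.x v * g⁻¹ := by rw [hg.conj_x]; simp
      have e2 : W.y (-((k ^ 2 * v)⁻¹ : Sˣ)) = g * W.y (-(v⁻¹ : Sˣ)) * g⁻¹ := by
        rw [hg.scales.conj_y, mul_inv]; simp
      rw [wt, wt, e1, e2]; group
    rw [← h1, h.wt_eq]
    have h2 := hg.inv.a_conj
    rw [inv_inv] at h2
    calc g * (t * W.a⁻¹) * g⁻¹ = g * t * (W.a⁻¹ * g⁻¹ * W.a) * W.a⁻¹ := by group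
      _ = _ := by rw [h2]
  scales := by
    have := (hg.scales.mul h.scales).mul hg.scales
    convert this using 1
    rw [mul_pow, ← pow_mul, mul_right_comm, ← pow_add]

theorem Lift.neg {v : Sˣ} {t : E} (h : W.Lift v t) : W.Lift (-v) (W.a * t⁻¹ * W.a) where
  wt_eq := by
    have h1 : W.wt (-v) = (W.wt v)⁻¹ := by
      simp only [wt, Units.val_neg, inv_neg, W.x_neg, W.y_neg]; group
    rw [h1, h.wt_eq]; group
  scales := by
    have h1 := (Scales.of_mem_center W.a_sq).mul h.scales.inv.conj_a
    convert h1 using 1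
    · simp only [pow_two]; group
    · simp

theorem Lift.conj_x {v : Sˣ} {t : E} (h : W.Lift v t) (s : S) :
    W.wt v * W.x s * (W.wt v)⁻¹ = W.y (-(((v ^ 2)⁻¹ : Sˣ) * s)) := by
  rw [h.wt_eq, ← mul_neg, ← h.scales.conj_y, y, neg_neg, ← a_inv_conj]; group

theorem Lift.conj_y {v : Sˣ} {t : E} (h : W.Lift v t) (s : S) :
    W.wt v * W.y s * (W.wt v)⁻¹ = W.x (-((v ^ 2 : Sˣ) * s)) := by
  rw [h.wt_eq, ← mul_neg, ← h.scales.conj_x, y]; group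

theorem Lift.conj_y' {v : Sˣ} {t : E} (h : W.Lift v t) (s : S) :
    (W.wt v)⁻¹ * W.y s * (W.wt v) = W.x (-((v ^ 2 : Sˣ) * s)) := by
  have := h.conj_x (-((v ^ 2 : Sˣ) * s))
  rw [mul_neg, neg_neg, Units.inv_mul_cancel_left] at this
  rw [← this]; group

/-- Conjugating the word `wt v` by itself exchanges upper and lower unipotents, so `wt v = y(-v⁻¹)
x(v) y(-v⁻¹)`; solve for `x(v)`. -/
theorem Lift.x_eq {v : Sˣ} {t : E} (h : W.Lift v t) :
    W.x v = W.y ((v⁻¹ : Sˣ) : S) * W.wt v * W.y ((v⁻¹ : Sˣ) : S) := by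
  have h1 := h.conj_x v
  have h2 := h.conj_y (-(v⁻¹ : Sˣ))
  have e1 : -(((v ^ 2)⁻¹ : Sˣ) * v : S) = -(v⁻¹ : Sˣ) := by
    rw [pow_two, mul_inv, Units.val_mul, mul_assoc]; simp
  have e2 : -((v ^ 2 : Sˣ) * -(v⁻¹ : Sˣ) : S) = v := by
    rw [pow_two, Units.val_mul]; simp [mul_assoc]
  rw [e1] at h1
  rw [e2] at h2
  have h3 : W.wt v = W.y (-(v⁻¹ : Sˣ)) * W.x v * W.y (-(v⁻¹ : Sˣ)) := by
    calc W.wt v = W.wt v * W.wt v * (W.wt v)⁻¹ := by group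
      _ = (W.wt v * W.x v * (W.wt v)⁻¹) * (W.wt v * W.y (-(v⁻¹ : Sˣ)) * (W.wt v)⁻¹) *
          (W.wt v * W.x v * (W.wt v)⁻¹) := by nth_rw 2 [wt]; group
      _ = _ := by rw [h1, h2]
  rw [h3, W.y_neg]; group

/-- The Steinberg relation for units with `p + q = r`. -/
theorem Lift.wt_of_add {p q r : Sˣ} {tp tq tr : E} (hp : W.Lift p tp) (hq : W.Lift q tq)
    (hr : W.Lift r tr) (h : (p : S) + q = r) :
    W.wt (-(p * q * r⁻¹)) = W.a * tp⁻¹ * tr * tq⁻¹ := by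
  have hx : W.x r = W.x p * W.x q := by rw [← h, W.x_add]
  rw [hr.x_eq, hp.x_eq, hq.x_eq] at hx
  -- The outer lower unipotents, moved inwards past `wt p` and `wt q`, both become `x(n)` with `n =
  -- -pq/r`. The middle one is `y(-n⁻¹)`, so together they form `wt n`.
  have hw : W.wt r = W.y (-(r⁻¹ : Sˣ) + (p⁻¹ : Sˣ)) * W.wt p * W.y ((p⁻¹ : Sˣ) + (q⁻¹ : Sˣ)) *
      W.wt q * W.y ((q⁻¹ : Sˣ) + -(r⁻¹ : Sˣ)) := by
    simp only [W.y_add, W.y_neg]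
    calc W.wt r = (W.y ((r⁻¹ : Sˣ) : S))⁻¹ * (W.y ((r⁻¹ : Sˣ) : S) * W.wt r * W.y ((r⁻¹ : Sˣ) : S))
        * (W.y ((r⁻¹ : Sˣ) : S))⁻¹ := by group
      _ = _ := by rw [hx]; group
  have k1 := hp.conj_y' (-(r⁻¹ : Sˣ) + (p⁻¹ : Sˣ))
  have k2 := hq.conj_y ((q⁻¹ : Sˣ) + -(r⁻¹ : Sˣ))
  have hpi := p.mul_inv
  have hqi := q.mul_inv
  have hri := r.mul_inv
  have e1 : -(((p ^ 2 : Sˣ) : S) * (-(r⁻¹ : Sˣ) + (p⁻¹ : Sˣ))) = ((-(p * q * r⁻¹) : Sˣ) : S) := by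
    push_cast
    linear_combination (-(p : S)) * hpi + (p : S) * hri + (p : S) * (r⁻¹ : Sˣ) * h
  have e2 : -(((q ^ 2 : Sˣ) : S) * ((q⁻¹ : Sˣ) + -(r⁻¹ : Sˣ))) = ((-(p * q * r⁻¹) : Sˣ) : S) := by
    push_cast
    linear_combination (-(q : S)) * hqi + (q : S) * hri + (q : S) * (r⁻¹ : Sˣ) * h
  have e3 : ((p⁻¹ : Sˣ) : S) + (q⁻¹ : Sˣ) = -((-(p * q * r⁻¹))⁻¹ : Sˣ) := by
    have : (-(p * q * r⁻¹))⁻¹ = -(p⁻¹ * q⁻¹ * r) := by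
      rw [inv_neg, mul_inv, mul_inv, inv_inv]
    rw [this]
    push_cast
    linear_combination (p⁻¹ : Sˣ) * (q⁻¹ : Sˣ) * h - (q⁻¹ : Sˣ) * hpi - (p⁻¹ : Sˣ) * hqi
  rw [e1] at k1
  rw [e2] at k2
  calc W.wt (-(p * q * r⁻¹)) = (W.wt p)⁻¹ * W.wt r * (W.wt q)⁻¹ := by
        rw [wt, ← e3]
        nth_rw 1 [← k1]
        nth_rw 1 [← k2]
        rw [hw]; group
    _ = _ := by rw [hp.wt_eq, hq.wt_eq, hr.wt_eq]; group

theorem Lift.swap {p q r : Sˣ} {tp tq tr : E} (hp : W.Lift p tp) (hq : W.Lift q tq)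
    (hr : W.Lift r tr) (h : (p : S) + q = r) : tp⁻¹ * tr * tq⁻¹ = tq⁻¹ * tr * tp⁻¹ := by
  have h1 := hp.wt_of_add hq hr h
  rw [mul_comm p q, hq.wt_of_add hp hr (by rw [add_comm, h])] at h1
  simpa [mul_assoc] using h1.symm

end WeylSystem

/-! ### Operators that commute modulo the centre. -/

open scoped IsMulCommutative in
/-- A group of operators which commute modulo the center generates a commutative ring of
endomorphisms of the group generated by the orbit of `x₀`, as soon as the latter is abelian. -/
theorem exists_ring_of_conj_commute {E : Type v} [Group E] (T : Subgroup E)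
    (hT : ∀ s ∈ T, ∀ t ∈ T, ⁅s, t⁆ ∈ Subgroup.center E) (x₀ : E)
    (hx₀ : ∀ t ∈ T, Commute x₀ (t * x₀ * t⁻¹)) :
    ∃ (S : Type v) (_ : CommRing S) (x : S → E) (C : T →* Sˣ),
      (∀ s t, x (s + t) = x s * x t) ∧ Function.Injective x ∧ x 1 = x₀ ∧
      ∀ (t : T) (s : S), (t : E) * x s * (t : E)⁻¹ = x (C t * s) := by
  set X : Set E := Set.range fun t : T => (t : E) * x₀ * (t : E)⁻¹ with hX
  have hcomm : ∀ g ∈ X, ∀ h ∈ X, g * h = h * g := by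
    rintro _ ⟨t, rfl⟩ _ ⟨s, rfl⟩
    have h := (hx₀ ((t : E)⁻¹ * s) (T.mul_mem (T.inv_mem t.2) s.2)).eq
    have h2 : (t : E) * (x₀ * ((t : E)⁻¹ * s * x₀ * ((t : E)⁻¹ * s)⁻¹)) * (t : E)⁻¹ =
      t * (((t : E)⁻¹ * s * x₀ * ((t : E)⁻¹ * s)⁻¹) * x₀) * (t : E)⁻¹ := congrArg (t * · * (t : E)⁻¹) h
    calc _ = (t : E) * (x₀ * ((t : E)⁻¹ * s * x₀ * ((t : E)⁻¹ * s)⁻¹)) * (t : E)⁻¹ := by group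
      _ = _ := by rw [h2]; group
  set N : Subgroup E := Subgroup.closure X with hN
  have : IsMulCommutative N := Subgroup.isMulCommutative_closure hcomm
  have hmem : ∀ t : T, (t : E) * x₀ * (t : E)⁻¹ ∈ N := fun t => Subgroup.subset_closure ⟨t, rfl⟩
  have hstab : ∀ t ∈ T, ∀ g ∈ N, t * g * t⁻¹ ∈ N := by
    intro t ht g hg
    have : N ≤ N.comap (MulAut.conj t).toMonoidHom := by
      rw [hN, Subgroup.closure_le]
      rintro _ ⟨s, rfl⟩
      simp only [SetLike.mem_coe, Subgroup.mem_comap, MulEquiv.coe_toMonoidHom, MulAut.conj_apply]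
      have := hmem (⟨t, ht⟩ * s)
      simpa [mul_assoc] using this
    exact this hg
  let ρ : T →* AddMonoid.End (Additive N) :=
    { toFun := fun t => MonoidHom.toAdditive
        { toFun := fun g => (⟨t * g * (t : E)⁻¹, hstab t t.2 g g.2⟩ : N)
          map_one' := by ext; simp
          map_mul' := fun g h => by ext; simp }
      map_one' := by
        refine AddMonoidHom.ext fun g => ?_
        apply Additive.toMul.injective
        ext
        change ((1 : T) : E) * (g.toMul : E) * ((1 : T) : E)⁻¹ = (g.toMul : E)
        simp
      map_mul' := fun s t => by
        refine AddMonoidHom.ext fun g => ?_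
        apply Additive.toMul.injective
        ext
        change ((s * t : T) : E) * (g.toMul : E) * ((s * t : T) : E)⁻¹ =
          s * (t * (g.toMul : E) * (t : E)⁻¹) * (s : E)⁻¹
        simp [mul_assoc] }
  have hρ : ∀ (t : T) (g : Additive N), ((ρ t g).toMul : E) = t * (g.toMul : E) * (t : E)⁻¹ :=
    fun t g => rfl
  have hρcomm : ∀ f ∈ Set.range ρ, ∀ g ∈ Set.range ρ, f * g = g * f := by
    rintro _ ⟨s, rfl⟩ _ ⟨t, rfl⟩
    rw [← map_mul, ← map_mul]
    refine AddMonoidHom.ext fun g => ?_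
    apply Additive.toMul.injective
    ext
    refine (hρ (s * t) g).trans (Eq.trans ?_ (hρ (t * s) g).symm)
    have e1 : ((s * t : T) : E) = ⁅(s : E), (t : E)⁆ * ((t * s : T) : E) := by
      simp [commutatorElement_def]
    have hc2 := Subgroup.mem_center_iff.1 (hT s s.2 t t.2)
    rw [e1, mul_inv_rev]
    have := hc2 (((t * s : T) : E) * (g.toMul : E) * ((t * s : T) : E)⁻¹)
    calc _ = ⁅(s : E), (t : E)⁆ * (((t * s : T) : E) * (g.toMul : E) * ((t * s : T) : E)⁻¹) *
          ⁅(s : E), (t : E)⁆⁻¹ := by group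
      _ = _ := by rw [← this]; group
  have : IsMulCommutative (Subring.closure (Set.range ρ)) :=
    Subring.isMulCommutative_closure hρcomm
  let C₀ : T →* Subring.closure (Set.range ρ) :=
    { toFun := fun t => ⟨ρ t, Subring.subset_closure ⟨t, rfl⟩⟩
      map_one' := Subtype.ext (map_one ρ)
      map_mul' := fun s t => Subtype.ext (map_mul ρ s t) }
  let n₀ : Additive N := Additive.ofMul ⟨x₀, by simpa using hmem 1⟩
  refine ⟨Subring.closure (Set.range ρ), inferInstance,
    fun s => (((s : AddMonoid.End (Additive N)) n₀).toMul : E), C₀.toHomUnits, ?_, ?_, ?_, ?_⟩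
  · intro s t
    rfl
  · intro s s' h
    have h1 : (s : AddMonoid.End (Additive N)) n₀ = (s' : AddMonoid.End (Additive N)) n₀ :=
      Additive.toMul.injective (Subtype.ext h)
    -- Injectivity: an element of the commutative ring is determined by its value at `n₀`, because
    -- `N` is generated by the translates `ρ t n₀`.
    have hgen : ∀ (s : Subring.closure (Set.range ρ)) (t : T),
        (s : AddMonoid.End (Additive N)) (ρ t n₀) =
          ρ t ((s : AddMonoid.End (Additive N)) n₀) := by
      intro s t
      have := congrArg Subtype.val (mul_comm s (C₀ t))
      exact DFunLike.congr_fun this n₀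
    apply Subtype.ext
    refine AddMonoidHom.ext fun g => ?_
    obtain ⟨g, hg⟩ := g
    induction hg using Subgroup.closure_induction with
    | mem g hg =>
      obtain ⟨t, rfl⟩ := hg
      have e := hgen s t
      rw [h1, ← hgen s' t] at e
      exact e
    | one => exact (map_zero _).trans (map_zero _).symm
    | mul g g' hg hg' e e' =>
      have m := fun f : AddMonoid.End (Additive N) =>
        map_add f (Additive.ofMul (⟨g, hg⟩ : N)) (Additive.ofMul (⟨g', hg'⟩ : N))
      exact ((m _).trans (congrArg₂ (· + ·) e e')).trans (m _).symm
    | inv g hg e =>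
      have m := fun f : AddMonoid.End (Additive N) =>
        map_neg f (Additive.ofMul (⟨g, hg⟩ : N))
      exact ((m _).trans (congrArg (- ·) e)).trans (m _).symm
  · rfl
  · intro t s
    rfl

theorem commutator_mem_center_iff {E : Type*} [Group E] {s t : E} :
    ⁅s, t⁆ ∈ Subgroup.center E ↔
      Commute (s : E ⧸ Subgroup.center E) (t : E ⧸ Subgroup.center E) := by
  rw [← QuotientGroup.eq_one_iff, ← commutatorElement_eq_one_iff_commute]
  rfl

theorem conj_eq_of_mk_eq {E : Type*} [Group E] {s t : E}
    (h : (s : E ⧸ Subgroup.center E) = t) (g : E) : s * g * s⁻¹ = t * g * t⁻¹ := by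
  have h1 := Subgroup.mem_center_iff.1 (QuotientGroup.eq.1 h) g
  have h2 : t = s * (s⁻¹ * t) := by group
  rw [h2, mul_inv_rev]
  calc s * g * s⁻¹ = s * (g * (s⁻¹ * t)) * (s⁻¹ * t)⁻¹ * s⁻¹ := by group
    _ = _ := by rw [h1]; group

theorem commutator_mem_center_of_mem_closure {E : Type*} [Group E] {G : Set E}
    (hG : ∀ s ∈ G, ∀ t ∈ G, ⁅s, t⁆ ∈ Subgroup.center E) :
    ∀ s ∈ Subgroup.closure G, ∀ t ∈ Subgroup.closure G, ⁅s, t⁆ ∈ Subgroup.center E := by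
  simp only [commutator_mem_center_iff] at hG ⊢
  intro s hs t ht
  induction hs, ht using Subgroup.closure_induction₂ with
  | mem s t hs ht => exact hG s hs t ht
  | one_left => exact Commute.one_left _
  | one_right => exact Commute.one_right _
  | mul_left _ _ _ _ _ _ h h' => exact h.mul_left h'
  | mul_right _ _ _ _ _ _ h h' => exact h.mul_right h'
  | inv_left _ _ _ _ h => exact h.inv_left
  | inv_right _ _ _ _ h => exact h.inv_right

/-- If the elements of `G` commute modulo the center and contract the abelian subgroup `N`, then
all conjugates of `N` under the group generated by `G` commute with `N`. -/
theorem commute_conj_of_contracting {E : Type*} [Group E] {G : Set E}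
    (hG : ∀ s ∈ G, ∀ t ∈ G, ⁅s, t⁆ ∈ Subgroup.center E) {N : Subgroup E}
    (hN : ∀ m ∈ N, ∀ n ∈ N, Commute m n) (hGN : ∀ g ∈ G, ∀ n ∈ N, g⁻¹ * n * g ∈ N)
    {t : E} (ht : t ∈ Subgroup.closure G) {m n : E} (hm : m ∈ N) (hn : n ∈ N) :
    Commute n (t * m * t⁻¹) := by
  have hcomm := commutator_mem_center_of_mem_closure hG
  simp only [commutator_mem_center_iff] at hcomm
  have hle : ∀ p ∈ Submonoid.closure G, p ∈ Subgroup.closure G := fun p hp =>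
    (Submonoid.closure_le (S := (Subgroup.closure G).toSubmonoid)).2 Subgroup.subset_closure hp
  have hP : ∀ p ∈ Submonoid.closure G, ∀ n ∈ N, p⁻¹ * n * p ∈ N := by
    intro p hp
    induction hp using Submonoid.closure_induction with
    | mem g hg => exact hGN g hg
    | one => simp
    | mul p q _ _ h h' =>
      intro n hn
      have := h' _ (h n hn)
      simpa [mul_assoc] using this
  -- Modulo the centre every element is a fraction `p q⁻¹` of contracting ones. Conjugating by `p⁻¹`
  -- then moves both elements to be compared into `N`.
  have hfrac : ∃ p ∈ Submonoid.closure G, ∃ q ∈ Submonoid.closure G,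
      (t : E ⧸ Subgroup.center E) = (p * q⁻¹ : E) := by
    induction ht using Subgroup.closure_induction with
    | mem g hg => exact ⟨g, Submonoid.subset_closure hg, 1, one_mem _, by simp⟩
    | one => exact ⟨1, one_mem _, 1, one_mem _, by simp⟩
    | mul s t _ _ hs ht =>
      obtain ⟨p, hp, q, hq, h⟩ := hs
      obtain ⟨p', hp', q', hq', h'⟩ := ht
      refine ⟨p * p', mul_mem hp hp', q * q', mul_mem hq hq', ?_⟩
      have c1 := (hcomm q (hle q hq) p' (hle _ hp')).inv_left
      have c2 := (hcomm q (hle q hq) q' (hle _ hq')).inv_inv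
      simp only [QuotientGroup.mk_mul, QuotientGroup.mk_inv] at h h' ⊢
      rw [h, h', mul_assoc, ← mul_assoc _ (p' : E ⧸ Subgroup.center E), c1.eq, mul_inv_rev,
        ← c2.eq]
      simp only [mul_assoc]
    | inv t _ ht =>
      obtain ⟨p, hp, q, hq, h⟩ := ht
      refine ⟨q, hq, p, hp, ?_⟩
      simp only [QuotientGroup.mk_mul, QuotientGroup.mk_inv] at h ⊢
      rw [h]; simp
  obtain ⟨p, hp, q, hq, h⟩ := hfrac
  rw [conj_eq_of_mk_eq h m]
  have h1 := (hN _ (hP p hp n hn) _ (hP q hq m hm)).eq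
  calc n * (p * q⁻¹ * m * (p * q⁻¹)⁻¹) = p * ((p⁻¹ * n * p) * (q⁻¹ * m * q)) * p⁻¹ := by group
    _ = _ := by rw [h1]; group

/-! ### Central lifts and their normalization. -/

namespace SE2

/-- A homomorphism under which the defining relations hold up to a central subgroup `A` of
exponent dividing `2r+1`. -/
structure CentralLift {r : ℕ} {E : Type*} [Group E] (A : Subgroup E) (f : F r →* E) : Prop where
  central : A ≤ Subgroup.center E
  pow_eq_one : ∀ α ∈ A, α ^ (2 * r + 1) = 1
  rel : ∀ x y, DefRel r x y → f x * (f y)⁻¹ ∈ A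
  mem_center : ∀ c, (∀ i, Commute c (f (FreeGroup.of i))) → c ∈ Subgroup.center E

namespace CentralLift

variable {r : ℕ} {E : Type*} [Group E] {A : Subgroup E} {f : F r →* E}

theorem comm (h : CentralLift A f) {α : E} (hα : α ∈ A) (g : E) : g * α = α * g :=
  Subgroup.mem_center_iff.1 (h.central hα) g

theorem exists_eq_mul (h : CentralLift A f) {x y : F r} (hxy : DefRel r x y) :
    ∃ α ∈ A, f x = α * f y :=
  ⟨_, h.rel x y hxy, by group⟩

theorem inv_mul_mem (h : CentralLift A f) {x y : E} (hxy : x * y⁻¹ ∈ A) : x⁻¹ * y ∈ A := by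
  have e := h.comm hxy x⁻¹
  have : x⁻¹ * y = (x * y⁻¹)⁻¹ := by
    calc x⁻¹ * y = ((x⁻¹ * (x * y⁻¹)) * x)⁻¹ := by group
      _ = _ := by rw [e]; group
  rw [this]
  exact A.inv_mem hxy

/-- The exponent is odd: `r + 1` is the inverse of `2` modulo `2r + 1`. -/
theorem exists_sq (h : CentralLift A f) {α : E} (hα : α ∈ A) : ∃ β ∈ A, β ^ 2 = α := by
  refine ⟨α ^ (r + 1), A.pow_mem hα _, ?_⟩
  rw [← pow_mul, show (r + 1) * 2 = 2 * r + 1 + 1 by ring, pow_succ, h.pow_eq_one α hα, one_mul]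

theorem eq_one_of_sq (h : CentralLift A f) {α : E} (hα : α ∈ A) (h2 : α ^ 2 = 1) : α = 1 := by
  have := h.pow_eq_one α hα
  rwa [pow_succ, pow_mul, h2, one_pow, one_mul] at this

theorem mk_eq (h : CentralLift A f) {f' : F r →* E}
    (hf : ∀ i, (f (FreeGroup.of i))⁻¹ * f' (FreeGroup.of i) ∈ A) (g : F r) :
    (f g)⁻¹ * f' g ∈ A := by
  have hn : A.Normal := ⟨fun α hα g => by rw [h.comm hα]; simpa using hα⟩
  have : (QuotientGroup.mk' A).comp f = (QuotientGroup.mk' A).comp f' :=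
    FreeGroup.ext_hom _ _ fun i => QuotientGroup.eq.2 (hf i)
  exact QuotientGroup.eq.1 (DFunLike.congr_fun this g)

/-- Changing the images of the generators by elements of `A` gives another central lift. -/
theorem perturb (h : CentralLift A f) {f' : F r →* E}
    (hf : ∀ i, (f (FreeGroup.of i))⁻¹ * f' (FreeGroup.of i) ∈ A) : CentralLift A f' where
  central := h.central
  pow_eq_one := h.pow_eq_one
  rel x y hxy := by
    have h1 := h.mk_eq hf x
    have h2 := h.mk_eq hf y
    have h3 := h.rel x y hxy
    have h4 := A.mul_mem h1 (A.inv_mem h2)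
    have := A.mul_mem h3 h4
    convert this using 1
    have e := h.comm h4 (f y)⁻¹
    calc f' x * (f' y)⁻¹ = f x * (((f x)⁻¹ * f' x * ((f y)⁻¹ * f' y)⁻¹) * (f y)⁻¹) := by group
      _ = _ := by rw [← e]; group
  mem_center c hc := by
    refine h.mem_center c fun i => ?_
    have h1 := h.comm (hf i) c
    have e : f (FreeGroup.of i) = f' (FreeGroup.of i) *
      ((f (FreeGroup.of i))⁻¹ * f' (FreeGroup.of i))⁻¹ := by group
    rw [e]
    exact (hc i).mul_right (Commute.inv_right h1)

theorem commutator_eq (h : CentralLift A f) {f' : F r →* E}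
    (hf : ∀ i, (f (FreeGroup.of i))⁻¹ * f' (FreeGroup.of i) ∈ A) (g k : F r) :
    f' ⁅g, k⁆ = f ⁅g, k⁆ := by
  have e : ∀ g, f' g = f g * ((f g)⁻¹ * f' g) := fun g => by group
  have c := fun g => h.comm (h.mk_eq hf g)
  have hcomm : ∀ p q α β : E, (∀ x, x * α = α * x) → (∀ x, x * β = β * x) →
      ⁅p * α, q * β⁆ = ⁅p, q⁆ := by
    intro p q α β hα hβ
    have e1 : p * α * (q * β) * (p * α)⁻¹ * (q * β)⁻¹ =
        p * (α * (q * β * α⁻¹)) * p⁻¹ * β⁻¹ * q⁻¹ := by group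
    rw [commutatorElement_def, e1, ← hα]
    have e2 : p * (q * β * α⁻¹ * α) * p⁻¹ * β⁻¹ * q⁻¹ = p * q * (β * p⁻¹) * β⁻¹ * q⁻¹ := by group
    rw [e2, ← hβ, commutatorElement_def]; group
  rw [map_commutatorElement, map_commutatorElement, e g, e k]
  exact hcomm _ _ _ _ (c g) (c k)

end CentralLift

/-- A central lift under which the relations involving only the Weyl element and the torus, as
well as the definitions of the superfluous generators, hold exactly. -/
structure NormalizedLift {r : ℕ} {E : Type*} [Group E] (A : Subgroup E) (f : F r →* E) : Prop
    extends CentralLift A f where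
  a_pow : f a ^ 4 = 1
  z_a_z : f z * f a * f z = f a
  u_a_u : ∀ i, f (u i) * f a * f (u i) = f a
  bt_def : ∀ t : Fin (2 * r + 1),
    f (bt t) = f z ^ (r * (t : ℕ)) * f b * f z ^ (r * (t : ℕ)) * f a
  w_def : f w = f (z ^ cexp r * ((List.finRange r).map fun i => u i).prod)

variable {r : ℕ} {E : Type*} [Group E] {A : Subgroup E} {f : F r →* E}

/-- Central changes of `b`, and of `a`, `z`, `u_i` subject to the relations of the torus
normalizer, extend to a normalized lift. -/
theorem CentralLift.exists_normalized_of (h : CentralLift A f) (z' a' b' : E) (u' : Fin r → E)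
    (hz : (f z)⁻¹ * z' ∈ A) (ha : (f a)⁻¹ * a' ∈ A) (hb : (f b)⁻¹ * b' ∈ A)
    (hu : ∀ i, (f (u i))⁻¹ * u' i ∈ A) (ha4 : a' ^ 4 = 1) (hzaz : z' * a' * z' = a')
    (huau : ∀ i, u' i * a' * u' i = a') :
    ∃ f' : F r →* E, NormalizedLift A f' ∧
      (∀ i, (f (FreeGroup.of i))⁻¹ * f' (FreeGroup.of i) ∈ A) ∧
      f' z = z' ∧ f' a = a' ∧ f' b = b' ∧ ∀ i, f' (u i) = u' i := by
  let g₀ : Gen r → E := fun i => match i with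
    | .z => z' | .u i => u' i | .a => a' | .b => b'
    | .bt t => f (bt t)
    | .w => f w
  have h₀ : ∀ i, (f (FreeGroup.of i))⁻¹ * FreeGroup.lift g₀ (FreeGroup.of i) ∈ A := by
    intro i
    rw [FreeGroup.lift_apply_of]
    cases i with
    | z => exact hz
    | u i => exact hu i
    | a => exact ha
    | b => exact hb
    | bt t => simp [g₀, bt, A.one_mem]
    | w => simp [g₀, w, A.one_mem]
  let g₁ : Gen r → E := fun i => match i with
    | .z => z' | .u i => u' i | .a => a' | .b => b'
    | .bt t => z' ^ (r * (t : ℕ)) * b' * z' ^ (r * (t : ℕ)) * a'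
    | .w => z' ^ cexp r * ((List.finRange r).map fun i => u' i).prod
  have hz₀ : FreeGroup.lift g₀ z = z' := FreeGroup.lift_apply_of
  have ha₀ : FreeGroup.lift g₀ a = a' := FreeGroup.lift_apply_of
  have hb₀ : FreeGroup.lift g₀ b = b' := FreeGroup.lift_apply_of
  have hu₀ : ∀ i, FreeGroup.lift g₀ (u i) = u' i := fun i => FreeGroup.lift_apply_of
  have hz₁ : FreeGroup.lift g₁ z = z' := FreeGroup.lift_apply_of
  have ha₁ : FreeGroup.lift g₁ a = a' := FreeGroup.lift_apply_of
  have hb₁ : FreeGroup.lift g₁ b = b' := FreeGroup.lift_apply_of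
  have hu₁ : ∀ i, FreeGroup.lift g₁ (u i) = u' i := fun i => FreeGroup.lift_apply_of
  have hL₀ := h.perturb h₀
  have h₁ : ∀ i, (f (FreeGroup.of i))⁻¹ * FreeGroup.lift g₁ (FreeGroup.of i) ∈ A := by
    intro i
    rw [FreeGroup.lift_apply_of]
    cases i with
    | z => exact hz
    | u i => exact hu i
    | a => exact ha
    | b => exact hb
    | bt t =>
      have e := hL₀.rel _ _ (.bt_def t)
      simp only [map_mul, map_pow, hz₀, ha₀, hb₀] at e
      have e2 : FreeGroup.lift g₀ (bt t) = f (bt t) := FreeGroup.lift_apply_of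
      rw [e2] at e
      exact h.inv_mul_mem e
    | w =>
      have e := hL₀.rel _ _ .w_def
      have e2 : FreeGroup.lift g₀ w = f w := FreeGroup.lift_apply_of
      rw [map_mul, map_pow, hz₀, map_list_prod, List.map_map, e2] at e
      have e3 : (FreeGroup.lift g₀) ∘ (fun i : Fin r => u i) = u' := funext hu₀
      rw [e3] at e
      exact h.inv_mul_mem e
  refine ⟨FreeGroup.lift g₁, { h.perturb h₁ with
    a_pow := by rw [ha₁, ha4]
    z_a_z := by rw [hz₁, ha₁, hzaz]
    u_a_u := fun i => by rw [hu₁, ha₁, huau]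
    bt_def := fun t => by
      rw [hz₁, ha₁, hb₁]; exact FreeGroup.lift_apply_of
    w_def := by
      rw [map_mul, map_pow, hz₁, map_list_prod, List.map_map]
      refine (FreeGroup.lift_apply_of).trans ?_
      rw [show FreeGroup.lift g₁ ∘ (fun i : Fin r => u i) = u' from funext hu₁] }, h₁, hz₁, ha₁, hb₁, hu₁⟩
end SE2

namespace SE2

variable {r : ℕ} {E : Type*} [Group E] {A : Subgroup E} {f : F r →* E}

/-- Replacing `t` by `t β` multiplies `t a t` by `β²`, so a square root of the error suffices; the
central factor `c` plays no role. -/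
theorem CentralLift.exists_inverted (h : CentralLift A f) {t c : E} (hc : c ∈ A)
    (ht : f a * (t * f a * t)⁻¹ ∈ A) :
    ∃ t', t⁻¹ * t' ∈ A ∧ t' * (f a * c) * t' = f a * c := by
  obtain ⟨β, hβ, hβ2⟩ := h.exists_sq ht
  refine ⟨t * β, by simpa using hβ, ?_⟩
  have e1 : t * β * (f a * c) * (t * β) = (t * f a * t) * β ^ 2 * c := by
    have c1 := h.comm hβ
    have c2 := h.comm hc
    rw [c1 t]
    calc β * t * (f a * c) * (β * t) = β * t * f a * (c * (β * t)) := by group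
      _ = β * (t * f a * (β * t)) * c := by rw [← c2]; group
      _ = β * (t * f a * t * β) * c := by rw [← c1 t]; group
      _ = _ := by rw [c1 (t * f a * t), ← c1 (t * f a * t), ← c1 (t * f a * t * β)]; simp [pow_two, mul_assoc]
  rw [e1, hβ2, h.comm ht]
  group

theorem CentralLift.exists_normalized (h : CentralLift A f) :
    ∃ f' : F r →* E, NormalizedLift A f' ∧
      ∀ i, (f (FreeGroup.of i))⁻¹ * f' (FreeGroup.of i) ∈ A := by
  have ha := h.rel _ _ .a_pow
  simp only [map_pow, map_one, inv_one, mul_one] at ha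
  obtain ⟨β, hβ, hβ2⟩ := h.exists_sq (A.inv_mem ha)
  obtain ⟨γ, hγ, hγ2⟩ := h.exists_sq hβ
  have hz := h.rel _ _ .z_a_z
  have hu := fun i => h.rel _ _ (.u_a_u i)
  simp only [map_mul] at hz hu
  obtain ⟨z', hz', hz2⟩ := h.exists_inverted hγ hz
  choose u' hu' hu2 using fun i => h.exists_inverted hγ (hu i)
  -- `γ` is a fourth root of `(f a ^ 4)⁻¹`, obtained by taking square roots twice.
  have ha4 : (f a * γ) ^ 4 = 1 := by
    have hc : Commute (f a) γ := h.comm hγ _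
    rw [hc.mul_pow, show γ ^ 4 = (γ ^ 2) ^ 2 by rw [← pow_mul], hγ2, hβ2, mul_inv_cancel]
  obtain ⟨f', h1, h2, -⟩ := h.exists_normalized_of z' (f a * γ) (f b) u' hz' (by simpa using hγ)
    (by simp [A.one_mem]) hu' ha4 hz2 hu2
  exact ⟨f', h1, h2⟩

/-! ### Roots in a normalized lift. -/

/-- The image of the upper unipotent element corresponding to `ζ^n`. -/
def root (f : F r →* E) (n : ℕ) : E :=
  f z ^ (r * n) * (f b * (f a)⁻¹) * (f z ^ (r * n))⁻¹

namespace NormalizedLift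

theorem commute_sq_of_inverted {t c : E} (h : t * c * t = c) : Commute (c ^ 2) t := by
  have h1 : c * t = t⁻¹ * c := by rw [eq_inv_mul_iff_mul_eq, ← mul_assoc, h]
  have h2 : c * t⁻¹ = t * c := by rw [mul_inv_eq_iff_eq_mul, h]
  rw [commute_iff_eq, pow_two, mul_assoc, h1, ← mul_assoc, h2, mul_assoc]

theorem pow_inverted {t c : E} (h : t * c * t = c) (n : ℕ) : t ^ n * c * t ^ n = c := by
  induction n with
  | zero => simp
  | succ n ih =>
    calc t ^ (n + 1) * c * t ^ (n + 1) = t ^ n * (t * c * t) * t ^ n := by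
          rw [pow_succ, ← pow_succ t n, pow_succ']; group
      _ = c := by rw [h, ih]

/-- An element inverted by `a` commutes with `a²`, and `b` does because `a²` is `b³` up to `A`; the
other generators are words in these. -/
theorem a_sq_mem_center (h : NormalizedLift A f) : f a ^ 2 ∈ Subgroup.center E := by
  have hz : Commute (f a ^ 2) (f z) := commute_sq_of_inverted h.z_a_z
  have hu : ∀ i, Commute (f a ^ 2) (f (u i)) := fun i => commute_sq_of_inverted (h.u_a_u i)
  have ha : Commute (f a ^ 2) (f a) := (Commute.refl _).pow_left 2
  have hb : Commute (f a ^ 2) (f b) := by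
    obtain ⟨α, hα, e⟩ := h.exists_eq_mul .b_cube
    rw [map_pow, map_pow] at e
    have e2 : f a ^ 2 = α⁻¹ * f b ^ 3 := by rw [e]; group
    rw [e2]
    have c1 : Commute α (f b) := (h.comm hα _).symm
    exact (c1.inv_left).mul_left ((Commute.refl _).pow_left 3)
  refine h.mem_center _ fun i => ?_
  cases i with
  | z => exact hz
  | u i => exact hu i
  | a => exact ha
  | b => exact hb
  | bt t =>
    change Commute _ (f (bt t))
    rw [h.bt_def]
    exact (((hz.pow_right _).mul_right hb).mul_right (hz.pow_right _)).mul_right ha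
  | w =>
    change Commute _ (f w)
    rw [h.w_def, map_mul, map_pow, map_list_prod]
    refine (hz.pow_right _).mul_right (Commute.list_prod_right _ _ fun x hx => ?_)
    simp only [List.map_map, List.mem_map] at hx
    obtain ⟨i, -, rfl⟩ := hx
    exact hu i

/-- This power is central, being in `A`, and inverted by `a`; so its square is trivial, and `A` has
odd exponent. -/
theorem z_pow (h : NormalizedLift A f) : f z ^ (2 * r + 1) = 1 := by
  have h1 := h.rel _ _ .z_pow
  simp only [map_pow, map_one, inv_one, mul_one] at h1
  refine h.eq_one_of_sq h1 ?_
  have h2 := pow_inverted h.z_a_z (2 * r + 1)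
  rw [mul_assoc, h.comm h1, ← mul_assoc, mul_eq_right, ← pow_two] at h2
  exact h2

theorem root_mod (h : NormalizedLift A f) (n : ℕ) : root f (n % (2 * r + 1)) = root f n := by
  have : f z ^ (r * (n % (2 * r + 1))) = f z ^ (r * n) := by
    rw [pow_mul, pow_mul, ← pow_eq_pow_mod]
    rw [← pow_mul, mul_comm, pow_mul, h.z_pow, one_pow]
  rw [root, root, this]

theorem bt_eq (h : NormalizedLift A f) (t : Fin (2 * r + 1)) :
    f (bt t) = root f t * f a ^ 2 := by
  have h1 := pow_inverted h.z_a_z (r * (t : ℕ))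
  rw [h.bt_def, root]
  have h2 : f a * f z ^ (r * (t : ℕ)) = (f z ^ (r * (t : ℕ)))⁻¹ * f a := by
    rw [eq_inv_mul_iff_mul_eq, ← mul_assoc, h1]
  calc _ = f z ^ (r * (t : ℕ)) * (f b * (f a)⁻¹) * (f a * f z ^ (r * (t : ℕ))) * f a := by group
    _ = _ := by rw [h2]; simp only [pow_two, mul_assoc]

theorem pow_mul_of_commutator {p q c : E} (hc : c ∈ Subgroup.center E) (h : p * q = c * (q * p))
    (n : ℕ) : p ^ n * q = c ^ n * (q * p ^ n) := by
  induction n with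
  | zero => simp
  | succ n ih =>
    have hc' : ∀ g, g * c = c * g := Subgroup.mem_center_iff.1 hc
    calc p ^ (n + 1) * q = p * (p ^ n * q) := by rw [pow_succ', mul_assoc]
      _ = p * c ^ n * (q * p ^ n) := by rw [ih, mul_assoc]
      _ = c ^ n * (p * q) * p ^ n := by
        rw [show p * c ^ n = c ^ n * p from (Commute.pow_right (hc' p) n)]; group
      _ = _ := by rw [h, pow_succ, pow_succ']; group

/-- The commutator is central of exponent `ℓ`, so `ℓ`-th powers commute. Up to `A` these are the
conjugates by `w` of `b_s^{±1}` and `b_t^{±1}`, with a common sign, and the conjugation can be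
undone. -/
theorem bt_commute (h : NormalizedLift A f) (s t : Fin (2 * r + 1)) :
    Commute (f (bt s)) (f (bt t)) := by
  have h1 := h.rel _ _ (.b_b s t)
  simp only [map_one, inv_one, mul_one, map_commutatorElement] at h1
  have h2 := pow_mul_of_commutator (p := f (bt s)) (q := f (bt t)) (h.central h1)
    (by rw [commutatorElement_def]; group) (2 * r + 1)
  rw [h.pow_eq_one _ h1, one_mul] at h2
  have h3 : Commute (f (bt s) ^ (2 * r + 1)) (f (bt t) ^ (2 * r + 1)) :=
    Commute.pow_right h2 _
  obtain ⟨α, hα, e⟩ := h.exists_eq_mul (.b_pow s)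
  obtain ⟨β, hβ, e'⟩ := h.exists_eq_mul (.b_pow t)
  simp only [map_mul, map_pow, map_inv, map_zpow] at e e'
  have h4 : Commute ((f w)⁻¹ * f (bt s) ^ ((-1 : ℤ) ^ r) * f w)
      ((f w)⁻¹ * f (bt t) ^ ((-1 : ℤ) ^ r) * f w) := by
    have e1 : (f w)⁻¹ * f (bt s) ^ ((-1 : ℤ) ^ r) * f w = α⁻¹ * f (bt s) ^ (2 * r + 1) := by
      rw [e]; group
    have e2 : (f w)⁻¹ * f (bt t) ^ ((-1 : ℤ) ^ r) * f w = β⁻¹ * f (bt t) ^ (2 * r + 1) := by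
      rw [e']; group
    rw [e1, e2]
    have cα : ∀ g, Commute α⁻¹ g := fun g => (h.comm (A.inv_mem hα) g).symm
    have cβ : ∀ g, Commute g β⁻¹ := fun g => h.comm (A.inv_mem hβ) g
    exact (cα _).mul_left ((cβ _).mul_right h3)
  have h5 : Commute (f (bt s) ^ ((-1 : ℤ) ^ r)) (f (bt t) ^ ((-1 : ℤ) ^ r)) := by
    have := congrArg (fun g => f w * g * (f w)⁻¹) h4.eq
    rw [commute_iff_eq]
    calc _ = f w * ((f w)⁻¹ * f (bt s) ^ ((-1 : ℤ) ^ r) * f w *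
          ((f w)⁻¹ * f (bt t) ^ ((-1 : ℤ) ^ r) * f w)) * (f w)⁻¹ := by group
      _ = _ := this
      _ = _ := by group
  rcases neg_one_pow_eq_or ℤ r with e | e
  · simpa [e] using h5
  · simpa [e] using h5

theorem root_commute (h : NormalizedLift A f) (m n : ℕ) : Commute (root f m) (root f n) := by
  have key : ∀ n, ∃ t, root f n = f (bt t) * (f a ^ 2)⁻¹ := fun n =>
    ⟨⟨n % (2 * r + 1), Nat.mod_lt _ (by omega)⟩, by
      rw [h.bt_eq, mul_inv_cancel_right, h.root_mod]⟩
  obtain ⟨s, hs⟩ := key m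
  obtain ⟨t, ht⟩ := key n
  rw [hs, ht]
  have hc : ∀ g, Commute (f a ^ 2)⁻¹ g := fun g =>
    (Subgroup.mem_center_iff.1 (inv_mem h.a_sq_mem_center) g).symm
  exact ((h.bt_commute s t).mul_right (hc _).symm).mul_left (hc _)

theorem z_conj_root (f : F r →* E) (k n : ℕ) :
    f z ^ (r * k) * root f n * (f z ^ (r * k))⁻¹ = root f (k + n) := by
  rw [root, root, mul_add, pow_add]; group

theorem z_inv (h : NormalizedLift A f) : (f z)⁻¹ = f z ^ (r * 2) := by
  rw [inv_eq_iff_mul_eq_one, ← pow_succ', mul_comm, h.z_pow]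

/-- Here `X = x₀`, `b = X a`, `b₀ = X a²` and `Z = z^{ri}`. Since `a` inverts `Z` and `U`, every `a`
can be moved to the right and cancelled. -/
theorem conj_eq_of_last {X a Z U α : E} (hα : ∀ g, g * α = α * g)
    (ha : ∀ g, g * a ^ 2 = a ^ 2 * g) (ha4 : a ^ 4 = 1) (hU : U * a * U = a) (hZ : Z * a * Z = a)
    (h : X * a * a ^ 2 = α * (U * (X * a) * Z⁻¹ * (X * a)⁻¹ * (X * a ^ 2)⁻¹ * Z * (X * a) *
      Z ^ 2 * U)) :
    U⁻¹ * X * U = X * ((Z * X * Z⁻¹) ^ 2)⁻¹ * (Z ^ 2 * X * (Z ^ 2)⁻¹) * α := by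
  have h1 : a * Z = Z⁻¹ * a := by rw [eq_inv_mul_iff_mul_eq, ← mul_assoc, hZ]
  have h2 : a * U = U⁻¹ * a := by rw [eq_inv_mul_iff_mul_eq, ← mul_assoc, hU]
  have h3 : a * Z⁻¹ * a⁻¹ = Z := by
    rw [mul_inv_eq_iff_eq_mul, mul_inv_eq_iff_eq_mul, hZ]
  have h4 : a * Z ^ 2 * U = (Z ^ 2)⁻¹ * U⁻¹ * a := by
    calc a * Z ^ 2 * U = (a * Z) * Z * U := by rw [pow_two]; group
      _ = Z⁻¹ * (a * Z) * U := by rw [← mul_assoc Z⁻¹, ← h1]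
      _ = Z⁻¹ * Z⁻¹ * (a * U) := by rw [h1]; group
      _ = _ := by rw [h2, pow_two]; group
  set Y := X * ((Z * X * Z⁻¹) ^ 2)⁻¹ * (Z ^ 2 * X * (Z ^ 2)⁻¹) with hY
  have h5 : (a ^ 2)⁻¹ = a ^ 2 := by
    rw [inv_eq_iff_mul_eq_one, ← pow_add]; exact ha4
  have h6 : X * a * a ^ 2 = α * (U * Y * U⁻¹) * a * a ^ 2 := by
    rw [h]
    calc _ = α * (U * X * (a * Z⁻¹ * a⁻¹) * X⁻¹ * ((a ^ 2)⁻¹ * (X⁻¹ * Z * X * (a * Z ^ 2 * U)))) := by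
          group
      _ = α * (U * X * Z * X⁻¹ * (X⁻¹ * Z * X * ((Z ^ 2)⁻¹ * U⁻¹ * a)) * a ^ 2) := by
          rw [h3, h4, h5, ← ha]; group
      _ = _ := by rw [hY]; simp only [pow_two]; group
  have h7 : X = α * (U * Y * U⁻¹) := mul_right_cancel (mul_right_cancel h6)
  calc U⁻¹ * X * U = U⁻¹ * α * U * Y := by nth_rw 1 [h7]; group
    _ = _ := by rw [hα, hα]; group

theorem u_conj_root_zero_of_last (h : NormalizedLift A f) (i : Fin r) {α : E} (hα : α ∈ A)
    (e : f (b * a ^ 2) = α * f (u i * b * (z ^ (r * ((i : ℕ) + 1)))⁻¹ * b⁻¹ * (bt 0)⁻¹ *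
      z ^ (r * ((i : ℕ) + 1)) * b * (z ^ ((i : ℕ) + 1))⁻¹ * u i)) :
    (f (u i))⁻¹ * root f 0 * f (u i) =
      root f 0 * (root f (i + 1) ^ 2)⁻¹ * root f (2 * (i + 1)) * α := by
  have hz : (f z ^ ((i : ℕ) + 1))⁻¹ = (f z ^ (r * ((i : ℕ) + 1))) ^ 2 := by
    rw [inv_eq_iff_mul_eq_one, ← pow_mul, ← pow_add,
      show (i : ℕ) + 1 + r * ((i : ℕ) + 1) * 2 = (2 * r + 1) * ((i : ℕ) + 1) by ring, pow_mul,
      h.z_pow, one_pow]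
  have h0 : f b = root f 0 * f a := by simp [root]
  have hbt : f (bt 0) = root f 0 * f a ^ 2 := h.bt_eq 0
  simp only [map_mul, map_pow, map_inv, hbt, hz] at e
  rw [h0] at e
  have := conj_eq_of_last (h.comm hα) (Subgroup.mem_center_iff.1 h.a_sq_mem_center) h.a_pow
    (h.u_a_u i) (pow_inverted h.z_a_z _) e
  rw [this, z_conj_root, add_zero, ← pow_mul, mul_assoc r, z_conj_root, add_zero, mul_comm 2]

/-- Conjugation of `x₀` by `u_i`, up to an element of `A`. -/
theorem u_conj_root_zero (h : NormalizedLift A f) (i : Fin r) :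
    ∃ μ ∈ A, (f (u i))⁻¹ * root f 0 * f (u i) =
      root f 0 * (root f (i + 1) ^ 2)⁻¹ * root f (2 * (i + 1)) * μ := by
  obtain ⟨α, hα, e⟩ := h.exists_eq_mul (.last i)
  exact ⟨α, hα, h.u_conj_root_zero_of_last i hα e⟩

/-- The elements `z` and `u_i`. -/
def torusGens (f : F r →* E) : Set E := insert (f z) (Set.range fun i => f (u i))

/-- The subgroup generated by `z` and the `u_i`. -/
def torus (f : F r →* E) : Subgroup E := Subgroup.closure (torusGens f)

theorem commutator_torusGens (h : NormalizedLift A f) :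
    ∀ s ∈ torusGens f, ∀ t ∈ torusGens f, ⁅s, t⁆ ∈ A := by
  have h1 : ∀ i, ⁅f z, f (u i)⁆ ∈ A := fun i => by
    simpa using h.rel _ _ (.z_u i)
  have h2 : ∀ i j, ⁅f (u i), f (u j)⁆ ∈ A := fun i j => by
    simpa using h.rel _ _ (.u_u i j)
  rintro s (rfl | ⟨i, rfl⟩) t (rfl | ⟨j, rfl⟩)
  · simp [A.one_mem]
  · exact h1 j
  · rw [← commutatorElement_inv]; exact A.inv_mem (h1 i)
  · exact h2 i j

theorem z_mem_torus (f : F r →* E) : f z ∈ torus f := Subgroup.subset_closure (Set.mem_insert _ _)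

theorem u_mem_torus (f : F r →* E) (i : Fin r) : f (u i) ∈ torus f :=
  Subgroup.subset_closure (Set.mem_insert_of_mem _ ⟨i, rfl⟩)

theorem commutator_torus (h : NormalizedLift A f) :
    ∀ s ∈ torus f, ∀ t ∈ torus f, ⁅s, t⁆ ∈ Subgroup.center E :=
  commutator_mem_center_of_mem_closure fun s hs t ht =>
    h.central (h.commutator_torusGens s hs t ht)

/-- The group generated by the roots and `A`. -/
def unipotents (A : Subgroup E) (f : F r →* E) : Subgroup E :=
  Subgroup.closure (Set.range (root f) ∪ A)

theorem unipotents_commute (h : NormalizedLift A f) :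
    ∀ m ∈ unipotents A f, ∀ n ∈ unipotents A f, Commute m n := by
  intro m hm n hn
  induction hm, hn using Subgroup.closure_induction₂ with
  | mem s t hs ht =>
    rcases hs with ⟨m, rfl⟩ | hs
    · rcases ht with ⟨n, rfl⟩ | ht
      · exact h.root_commute m n
      · exact h.comm ht _
    · exact (h.comm hs _).symm
  | one_left => exact Commute.one_left _
  | one_right => exact Commute.one_right _
  | mul_left _ _ _ _ _ _ h h' => exact h.mul_left h'
  | mul_right _ _ _ _ _ _ h h' => exact h.mul_right h'
  | inv_left _ _ _ _ h => exact h.inv_left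
  | inv_right _ _ _ _ h => exact h.inv_right

theorem root_mem_unipotents (A : Subgroup E) (f : F r →* E) (n : ℕ) : root f n ∈ unipotents A f :=
  Subgroup.subset_closure (Or.inl ⟨n, rfl⟩)

theorem mem_unipotents_of_mem {α : E} (f : F r →* E) (hα : α ∈ A) : α ∈ unipotents A f :=
  Subgroup.subset_closure (Or.inr hα)

theorem u_conj_root (h : NormalizedLift A f) (i : Fin r) (n : ℕ) :
    (f (u i))⁻¹ * root f n * f (u i) =
      f z ^ (r * n) * ((f (u i))⁻¹ * root f 0 * f (u i)) * (f z ^ (r * n))⁻¹ := by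
  have hc : ⁅(f (u i))⁻¹, f z ^ (r * n)⁆ ∈ Subgroup.center E :=
    h.commutator_torus _ (inv_mem (u_mem_torus f i)) _ (pow_mem (z_mem_torus f) _)
  have hm := commutator_mem_center_iff.1 hc
  have := conj_eq_of_mk_eq (s := (f (u i))⁻¹ * f z ^ (r * n)) (t := f z ^ (r * n) * (f (u i))⁻¹)
    hm (root f 0)
  calc _ = (f (u i))⁻¹ * f z ^ (r * n) * root f 0 * ((f (u i))⁻¹ * f z ^ (r * n))⁻¹ := by
        simp only [root, mul_zero, pow_zero]; group
    _ = _ := by rw [this]; group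

/-- Only conjugation by the inverses of the generators is controlled: `u_i⁻¹` acts by the polynomial
`(1-ζ^i)²` in `ζ`, whose inverse need not be one. -/
theorem contracting (h : NormalizedLift A f) :
    ∀ g ∈ torusGens f, ∀ n ∈ unipotents A f, g⁻¹ * n * g ∈ unipotents A f := by
  have hz : ∀ k, ∀ n ∈ unipotents A f,
      f z ^ (r * k) * n * (f z ^ (r * k))⁻¹ ∈ unipotents A f := by
    intro k n hn
    have : unipotents A f ≤ (unipotents A f).comap (MulAut.conj (f z ^ (r * k))).toMonoidHom := by
      rw [unipotents, Subgroup.closure_le]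
      rintro α (⟨n, rfl⟩ | hα)
      · change f z ^ (r * k) * root f n * (f z ^ (r * k))⁻¹ ∈ unipotents A f
        rw [z_conj_root]
        exact root_mem_unipotents A f _
      · change f z ^ (r * k) * α * (f z ^ (r * k))⁻¹ ∈ unipotents A f
        rw [h.comm hα, mul_inv_cancel_right]
        exact mem_unipotents_of_mem f hα
    exact this hn
  rintro g (rfl | ⟨i, rfl⟩) n hn
  · have := hz 2 n hn
    rwa [← h.z_inv, inv_inv] at this
  · have : unipotents A f ≤ (unipotents A f).comap (MulAut.conj (f (u i))⁻¹).toMonoidHom := by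
      rw [unipotents, Subgroup.closure_le]
      rintro α (⟨n, rfl⟩ | hα)
      · change (f (u i))⁻¹ * root f n * (f (u i))⁻¹⁻¹ ∈ unipotents A f
        rw [inv_inv, h.u_conj_root]
        apply hz
        obtain ⟨μ, hμ, e⟩ := h.u_conj_root_zero i
        rw [e]
        have hr := root_mem_unipotents A f
        exact mul_mem (mul_mem (mul_mem (hr _) (inv_mem (pow_mem (hr _) 2))) (hr _))
          (mem_unipotents_of_mem f hμ)
      · change (f (u i))⁻¹ * α * (f (u i))⁻¹⁻¹ ∈ unipotents A f
        rw [h.comm hα, mul_inv_cancel_right]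
        exact mem_unipotents_of_mem f hα
    have := this hn
    change (f (u i))⁻¹ * n * (f (u i))⁻¹⁻¹ ∈ unipotents A f at this
    rwa [inv_inv] at this

end NormalizedLift
end SE2

/-! ### The coefficient ring and exact lifts. -/

namespace SE2

variable {r : ℕ} {E : Type v} [Group E] {A : Subgroup E} {f : F r →* E}

theorem x_sub_of_add {S : Type*} [CommRing S] {x : S → E} (hx : ∀ s t, x (s + t) = x s * x t)
    (s t : S) : x (s - t) = x s * (x t)⁻¹ := by
  rw [eq_mul_inv_iff_mul_eq, ← hx, sub_add_cancel]

theorem x_one_sub_sq {S : Type*} [CommRing S] {x : S → E} (hx : ∀ s t, x (s + t) = x s * x t)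
    (s : S) (n : ℕ) :
    x ((1 - s ^ n) ^ 2) = x 1 * (x (s ^ n) ^ 2)⁻¹ * x (s ^ (2 * n)) := by
  rw [show (1 - s ^ n) ^ 2 = 1 - (s ^ n + s ^ n) + s ^ (2 * n) by ring, hx, x_sub_of_add hx, hx,
    pow_two]

namespace NormalizedLift

theorem exists_ring (h : NormalizedLift A f) :
    ∃ (S : Type v) (_ : CommRing S) (x : S → E) (C : torus f →* Sˣ),
      (∀ s t, x (s + t) = x s * x t) ∧ Function.Injective x ∧ x 1 = root f 0 ∧
      ∀ (t : torus f) (s : S), (t : E) * x s * (t : E)⁻¹ = x (C t * s) :=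
  exists_ring_of_conj_commute (torus f) h.commutator_torus (root f 0) fun _ ht =>
    commute_conj_of_contracting
      (fun s hs t ht => h.central (h.commutator_torusGens s hs t ht))
      h.unipotents_commute h.contracting ht (root_mem_unipotents A f 0)
      (root_mem_unipotents A f 0)

theorem x_pow_eq_root {S : Type*} [CommRing S] {x : S → E} {C : torus f →* Sˣ}
    (h1 : x 1 = root f 0)
    (hC : ∀ (t : torus f) (s : S), (t : E) * x s * (t : E)⁻¹ = x (C t * s)) (n : ℕ) :
    x (((C ⟨f z, z_mem_torus f⟩ ^ r : Sˣ) : S) ^ n) = root f n := by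
  have h := hC (⟨f z, z_mem_torus f⟩ ^ (r * n)) 1
  rw [mul_one, h1, map_pow, pow_mul (C _)] at h
  rw [← Units.val_pow_eq_pow_val, ← h]
  simp [root]

/-- The defects of the conjugation formulas for the different `u_i` agree. -/
theorem defect_eq (h : NormalizedLift A f) {μ : Fin r → E} (hμ : ∀ i, μ i ∈ A)
    (e : ∀ i, (f (u i))⁻¹ * root f 0 * f (u i) =
      root f 0 * (root f (i + 1) ^ 2)⁻¹ * root f (2 * (i + 1)) * μ i) (i j : Fin r) :
    μ i = μ j := by
  obtain ⟨S, _, x, C, hx, hinj, h1, hC⟩ := h.exists_ring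
  set ζ : S := ((C ⟨f z, z_mem_torus f⟩ ^ r : Sˣ) : S) with hζ
  have hroot : ∀ n, x (ζ ^ n) = root f n := x_pow_eq_root h1 hC
  let U : Fin r → torus f := fun i => ⟨f (u i), u_mem_torus f i⟩
  let d : Fin r → S := fun i => (C (U i)⁻¹ : S) - (1 - ζ ^ ((i : ℕ) + 1)) ^ 2
  have hxd : ∀ i, x (d i) = μ i := by
    intro i
    have hu := hC (U i)⁻¹ 1
    rw [mul_one, h1] at hu
    have hu' : x (C (U i)⁻¹ : S) = (f (u i))⁻¹ * root f 0 * f (u i) := by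
      rw [← hu]; simp [U]
    rw [x_sub_of_add hx, hu', e i, x_one_sub_sq hx, h1, hroot, hroot, h.comm (hμ i)]
    group
  -- `x (d i) = μ i` is central, hence fixed by the torus.
  have hinv : ∀ (t : torus f) i, (C t : S) * d i = d i := by
    intro t i
    apply hinj
    rw [← hC, hxd, h.comm (hμ i)]
    group
  have hζd : ∀ n i, ζ ^ n * d i = d i := by
    intro n i
    have := hinv (⟨f z, z_mem_torus f⟩ ^ (r * n)) i
    rwa [map_pow, pow_mul, Units.val_pow_eq_pow_val] at this
  -- `u_j⁻¹` acts as `(1-ζ^j)² + d_j` and fixes `d_i`, while `1-ζ^j` annihilates `d_i`. Exchanging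
  -- `i` and `j` then gives `d_i = d_j`.
  have hmul : ∀ i j, d j * d i = d i := by
    intro i j
    have h2 := hinv (U j)⁻¹ i
    have h3 := hζd ((j : ℕ) + 1) i
    simp only [d] at h2 h3 ⊢
    linear_combination h2 - (1 - ζ ^ ((j : ℕ) + 1)) * (-h3)
  rw [← hxd, ← hxd, ← hmul i j, mul_comm, hmul]

end NormalizedLift

/-- A normalized lift for which `u_i` acts on the roots by the expected formula. -/
structure ExactLift (A : Subgroup E) (f : F r →* E) : Prop extends NormalizedLift A f where
  conj_root : ∀ i, (f (u i))⁻¹ * root f 0 * f (u i) =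
    root f 0 * (root f (i + 1) ^ 2)⁻¹ * root f (2 * (i + 1))

/-- Replacing `b` by `b ν⁻¹` multiplies every root by `ν⁻¹`. The formula has total exponent `1` on
the left and `1 - 2 + 1 = 0` on the right, which absorbs the common defect `ν`. -/
theorem NormalizedLift.exists_exact (h : NormalizedLift A f) :
    ∃ f' : F r →* E, ExactLift A f' ∧
      ∀ i, (f (FreeGroup.of i))⁻¹ * f' (FreeGroup.of i) ∈ A := by
  choose μ hμ e using h.u_conj_root_zero
  obtain ⟨ν, hν, hμν⟩ : ∃ ν ∈ A, ∀ i, μ i = ν := by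
    rcases isEmpty_or_nonempty (Fin r) with h0 | ⟨⟨i⟩⟩
    · exact ⟨1, A.one_mem, fun i => h0.elim i⟩
    · exact ⟨μ i, hμ i, fun j => h.defect_eq hμ e j i⟩
  obtain ⟨f', h1, h2, hz, ha, hb, hu⟩ := h.exists_normalized_of (f z) (f a) (f b * ν⁻¹)
    (fun i => f (u i)) (by simp [A.one_mem]) (by simp [A.one_mem]) (by simpa using hν)
    (by simp [A.one_mem]) h.a_pow h.z_a_z h.u_a_u
  have hc : ∀ g, g * ν⁻¹ = ν⁻¹ * g := h.comm (A.inv_mem hν)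
  have hroot : ∀ n, root f' n = root f n * ν⁻¹ := by
    intro n
    rw [root, root, hz, ha, hb]
    calc _ = f z ^ (r * n) * f b * (ν⁻¹ * ((f a)⁻¹ * (f z ^ (r * n))⁻¹)) := by group
      _ = _ := by rw [← hc]; group
  refine ⟨f', { h1 with conj_root := fun i => ?_ }, h2⟩
  have e' := e i
  rw [hμν] at e'
  rw [hroot, hroot, hroot, hu]
  have c1 : ∀ p, (p * ν⁻¹) ^ 2 = p ^ 2 * (ν⁻¹) ^ 2 := fun p => Commute.mul_pow (hc p) 2
  calc _ = (f (u i))⁻¹ * root f 0 * (ν⁻¹ * f (u i)) := by group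
    _ = (f (u i))⁻¹ * root f 0 * f (u i) * ν⁻¹ := by rw [← hc]; group
    _ = root f 0 * (root f (i + 1) ^ 2)⁻¹ * root f (2 * (i + 1)) := by rw [e']; group
    _ = root f 0 * (ν⁻¹ * (ν⁻¹ ^ 2)⁻¹ * (ν⁻¹ * ((root f (i + 1) ^ 2)⁻¹ * root f (2 * (i + 1))))) := by
      group
    _ = _ := by rw [← hc ((root f (i + 1) ^ 2)⁻¹ * root f (2 * (i + 1))), c1]; group

/-- A homomorphic picture of `SL₂` over a ring in which the `u_i` and `z` are diagonal. -/
structure TorusModel (f : F r →* E) (S : Type*) [CommRing S] extends WeylSystem E S where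
  a_eq : a = f SE2.a
  x_one : x 1 = root f 0
  ζ : Sˣ
  v : Fin r → Sˣ
  ζ_pow : ζ ^ (2 * r + 1) = 1
  v_eq : ∀ i, (v i : S) = 1 - ζ ^ ((i : ℕ) + 1)
  torus_z : toWeylSystem.Torus (f z) (ζ⁻¹ ^ 2)
  torus_u : ∀ i, toWeylSystem.Torus (f (u i)) ((v i)⁻¹ ^ 2)

-- The square of `1-ζ^i` is the unit by which `u_i⁻¹` acts, so `1-ζ^i` is itself a unit.
open NormalizedLift in
theorem ExactLift.exists_model (h : ExactLift A f) :
    ∃ (S : Type v) (_ : CommRing S), Nonempty (TorusModel f S) := by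
  obtain ⟨S, hS, x, C, hx, hinj, h1, hC⟩ := h.exists_ring
  set Z : torus f := ⟨f z, z_mem_torus f⟩ with hZ
  set ζ : Sˣ := C Z ^ r with hζ
  have hroot : ∀ n, x ((ζ : S) ^ n) = root f n := NormalizedLift.x_pow_eq_root h1 hC
  let U : Fin r → torus f := fun i => ⟨f (u i), u_mem_torus f i⟩
  have hv2 : ∀ i : Fin r, (1 - (ζ : S) ^ ((i : ℕ) + 1)) ^ 2 = ((C (U i))⁻¹ : Sˣ) := by
    intro i
    apply hinj
    rw [x_one_sub_sq hx, h1, hroot, hroot, ← h.conj_root i]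
    have hu := hC (U i)⁻¹ 1
    rw [mul_one, h1, map_inv] at hu
    rw [← hu]; simp [U]
  have hunit : ∀ i : Fin r, IsUnit (1 - (ζ : S) ^ ((i : ℕ) + 1)) := fun i =>
    (isUnit_pow_iff two_ne_zero).1 (by rw [hv2]; exact Units.isUnit _)
  choose v hv using hunit
  have hZpow : C Z ^ (2 * r + 1) = 1 := by
    rw [← map_pow, show Z ^ (2 * r + 1) = 1 from Subtype.ext h.z_pow, map_one]
  have hvU : ∀ i, C (U i) = (v i)⁻¹ ^ 2 := by
    intro i
    rw [inv_pow, eq_comm, inv_eq_iff_eq_inv]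
    apply Units.ext
    rw [← hv2, ← hv]; simp
  have hCZ : C Z = ζ⁻¹ ^ 2 := by
    rw [inv_pow, hζ, ← pow_mul, eq_inv_iff_mul_eq_one, ← pow_succ', mul_comm]
    exact hZpow
  let W : WeylSystem E S := ⟨x, hx, f a, h.a_pow, h.a_sq_mem_center⟩
  refine ⟨S, hS, ⟨⟨W, rfl, h1, ζ, v, ?_, hv, ⟨?_, h.z_a_z⟩, fun i => ⟨?_, h.u_a_u i⟩⟩⟩⟩
  · rw [hζ, ← pow_mul, mul_comm, pow_mul, hZpow, one_pow]
  · intro s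
    rw [← hCZ]
    exact hC Z s
  · intro s
    rw [← hvU]
    exact hC (U i) s

end SE2

/-! ### Products of torus elements, and lifts with central constants. -/

namespace WeylSystem

variable {E S : Type*} [Group E] [CommRing S] {W : WeylSystem E S}

theorem Torus.one : W.Torus 1 1 where
  conj_x s := by simp
  inverted := by simp

theorem inverted_mul {t t' c : E} (h : t * c * t = c) (h' : t' * c * t' = c)
    (hc : Commute t t') : t * t' * c * (t * t') = c := by
  calc t * t' * c * (t * t') = t * (t' * c * t') * t := by rw [hc.eq]; nth_rw 1 [← hc.eq]; group
    _ = c := by rw [h', h]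

theorem Torus.mul {t t' : E} {k k' : Sˣ} (h : W.Torus t k) (h' : W.Torus t' k')
    (hc : Commute t t') : W.Torus (t * t') (k * k') where
  conj_x := (h.scales.mul h'.scales).conj_x
  inverted := inverted_mul h.inverted h'.inverted hc

theorem Torus.pow {t : E} {k : Sˣ} (h : W.Torus t k) (n : ℕ) : W.Torus (t ^ n) (k ^ n) := by
  induction n with
  | zero => simpa using Torus.one
  | succ n ih =>
    rw [pow_succ, pow_succ]
    exact ih.mul h ((Commute.refl t).pow_left n)

theorem Torus.zpow {t : E} {k : Sˣ} (h : W.Torus t k) (n : ℤ) : W.Torus (t ^ n) (k ^ n) := by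
  cases n with
  | ofNat n => simpa using h.pow n
  | negSucc n => simpa only [zpow_negSucc] using (h.pow (n + 1)).inv

theorem Torus.list_prod {ι : Type*} {t : ι → E} {k : ι → Sˣ} (l : List ι)
    (h : ∀ i, W.Torus (t i) (k i)) (hc : ∀ i ∈ l, ∀ j ∈ l, Commute (t i) (t j)) :
    W.Torus (l.map t).prod (l.map k).prod := by
  induction l with
  | nil => simpa using Torus.one
  | cons i l ih =>
    simp only [List.map_cons, List.prod_cons]
    refine (h i).mul (ih fun i hi j hj => hc i (by simp [hi]) j (by simp [hj]))
      (Commute.list_prod_right _ _ fun x hx => ?_)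
    obtain ⟨j, hj, rfl⟩ := List.mem_map.1 hx
    exact hc i (by simp) j (by simp [hj])

theorem Lift.conj_central {v k : Sˣ} {κ s g : E} (h : W.Lift v (κ * s)) (hκ : κ ∈ Subgroup.center E)
    (hg : W.Torus g (k ^ 2)) : W.Lift (k ^ 2 * v) (κ * (g * s * g)) := by
  refine (h.conj hg).congr rfl ?_
  rw [← mul_assoc g, Subgroup.mem_center_iff.1 hκ]
  group

theorem mul_inv_mul_of_inverted {s c : E} (h : s * c * s = c) : c * s⁻¹ * c = s * c ^ 2 := by
  rw [pow_two, ← mul_assoc, mul_left_inj, mul_inv_eq_iff_eq_mul, h]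

theorem Lift.neg_central {v : Sˣ} {κ s : E} (h : W.Lift v (κ * s)) (hκ : κ ∈ Subgroup.center E)
    (hs : s * W.a * s = W.a) : W.Lift (-v) (κ⁻¹ * W.a ^ 2 * s) := by
  refine h.neg.congr rfl ?_
  have h1 := Subgroup.mem_center_iff.1 (inv_mem hκ)
  have h2 := Subgroup.mem_center_iff.1 W.a_sq
  rw [mul_inv_rev, h1, ← mul_assoc, h1, mul_assoc, mul_assoc, ← mul_assoc W.a,
    mul_inv_mul_of_inverted hs, h2, mul_assoc]

theorem Lift.swap_central {p q r : Sˣ} {κp κq κr sp sq sr : E} (hp : W.Lift p (κp * sp))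
    (hq : W.Lift q (κq * sq)) (hr : W.Lift r (κr * sr)) (hκp : κp ∈ Subgroup.center E)
    (hκq : κq ∈ Subgroup.center E) (hκr : κr ∈ Subgroup.center E) (h : (p : S) + q = r) :
    sp⁻¹ * sr * sq⁻¹ = sq⁻¹ * sr * sp⁻¹ := by
  have h1 := hp.swap hq hr h
  have hp' := Subgroup.mem_center_iff.1 (inv_mem hκp)
  have hq' := Subgroup.mem_center_iff.1 (inv_mem hκq)
  have hr' := Subgroup.mem_center_iff.1 hκr
  have e : ∀ x y z : E, x * κp⁻¹ * (κr * y) * (z * κq⁻¹) = κp⁻¹ * κr * κq⁻¹ * (x * y * z) := by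
    intro x y z
    rw [hp', hq']
    calc _ = κp⁻¹ * (x * κr) * y * κq⁻¹ * z := by group
      _ = κp⁻¹ * κr * (x * y * κq⁻¹) * z := by rw [hr']; group
      _ = _ := by rw [hq']; group
  have e' : ∀ x y z : E, x * κq⁻¹ * (κr * y) * (z * κp⁻¹) = κp⁻¹ * κr * κq⁻¹ * (x * y * z) := by
    intro x y z
    rw [hp', hq']
    calc _ = κq⁻¹ * (x * κr) * y * κp⁻¹ * z := by group
      _ = κq⁻¹ * κr * (x * y * κp⁻¹) * z := by rw [hr']; group
      _ = (κq⁻¹ * κr) * κp⁻¹ * (x * y * z) := by rw [hp']; group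
      _ = _ := by rw [hp', hr' κq⁻¹]; group
  rw [mul_inv_rev, mul_inv_rev, e, e'] at h1
  exact mul_left_cancel h1

theorem Lift.eq_of_add {p q r n : Sˣ} {κp κq κr κn sp sq sr sn : E} (hp : W.Lift p (κp * sp))
    (hq : W.Lift q (κq * sq)) (hr : W.Lift r (κr * sr)) (hn : W.Lift n (κn * sn))
    (hκp : κp ∈ Subgroup.center E)
    (hκq : κq ∈ Subgroup.center E) (hκr : κr ∈ Subgroup.center E) (h : (p : S) + q = r)
    (hpqr : (n : S) * r = -(p * q)) :
    κp⁻¹ * κr * κq⁻¹ * (W.a * (sp⁻¹ * sr * sq⁻¹) * W.a) = κn * sn := by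
  have hn' : n = -(p * q * r⁻¹) := by
    rw [← neg_mul, eq_mul_inv_iff_mul_eq]
    exact Units.ext hpqr
  have h1 := hp.wt_of_add hq hr h
  rw [← hn', hn.wt_eq, eq_comm, eq_mul_inv_iff_mul_eq] at h1
  rw [← h1]
  have hp' := Subgroup.mem_center_iff.1 (inv_mem hκp)
  have hq' := Subgroup.mem_center_iff.1 (inv_mem hκq)
  have hr' := Subgroup.mem_center_iff.1 hκr
  rw [mul_inv_rev, mul_inv_rev, hp' sp⁻¹, hq' sq⁻¹]
  calc _ = κp⁻¹ * κr * (κq⁻¹ * (W.a * sp⁻¹ * sr)) * sq⁻¹ * W.a := by group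
    _ = κp⁻¹ * (κr * (W.a * sp⁻¹)) * sr * κq⁻¹ * sq⁻¹ * W.a := by rw [← hq']; group
    _ = (κp⁻¹ * W.a) * sp⁻¹ * κr * sr * κq⁻¹ * sq⁻¹ * W.a := by rw [← hr']; group
    _ = _ := by rw [← hp']; group

theorem list_prod_x_zpow {ι : Type*} (s : ι → S) (n : ι → ℤ) {c : E}
    (hc : c ∈ Subgroup.center E) (l : List ι) :
    (l.map fun i => (W.x (s i) * c) ^ n i).prod =
      W.x (l.map fun i => (n i : S) * s i).sum * c ^ (l.map n).sum := by
  have hc' := Subgroup.mem_center_iff.1 hc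
  induction l with
  | nil => simp [W.x_zero]
  | cons i l ih =>
    simp only [List.map_cons, List.prod_cons, List.sum_cons]
    have h1 : Commute (W.x (s i)) c := hc' _
    have h2 := Subgroup.mem_center_iff.1 (Subgroup.zpow_mem _ hc (n i))
    rw [ih, h1.mul_zpow, W.x_add, W.x_zsmul, zpow_add]
    calc _ = W.x (s i) ^ n i * (c ^ n i * W.x (l.map fun i => (n i : S) * s i).sum) *
          c ^ (l.map n).sum := by group
      _ = _ := by rw [← h2]; group

end WeylSystem

/-! ### Units lifted by the cube relations; `u_i` commutes with `z`. -/

namespace SE2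

variable {r : ℕ} {E S : Type*} [Group E] [CommRing S] {A : Subgroup E} {f : F r →* E}

theorem sum_coeffI {I : Finset (Fin r)} (hI : I.Nonempty) :
    ∑ t : Fin (2 * r + 1), coeffI I t = 0 := by
  have h := prod_one_sub_eq (R := ℤ) (r := r) 1 (by simp) I
  obtain ⟨i, hi⟩ := hI
  rw [Finset.prod_eq_zero hi (by simp)] at h
  simpa using h.symm

namespace TorusModel

theorem x_pow_eq_root (M : TorusModel f S) (n : ℕ) :
    M.x ((M.ζ : S) ^ n) = root f n := by
  have h1 := (M.torus_z.pow (r * n)).conj_x 1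
  -- `z` acts by `ζ⁻²`, and `-2r ≡ 1` modulo `2r + 1`.
  have h2 : ((M.ζ⁻¹ ^ 2) ^ (r * n) : Sˣ) = M.ζ ^ n := by
    rw [← pow_mul, ← mul_assoc, pow_mul, eq_comm]
    congr 1
    rw [inv_pow, eq_inv_iff_mul_eq_one, ← pow_succ', M.ζ_pow]
  rw [h2, mul_one, M.x_one] at h1
  rw [← Units.val_pow_eq_pow_val, ← h1]
  simp [root]

theorem a_sq_mem (M : TorusModel f S) : f a ^ 2 ∈ Subgroup.center E := M.a_eq ▸ M.a_sq

theorem bt_eq (M : TorusModel f S) (h : NormalizedLift A f) (t : Fin (2 * r + 1)) :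
    f (bt t) = M.x ((M.ζ : S) ^ (t : ℕ)) * f a ^ 2 := by
  rw [M.x_pow_eq_root, h.bt_eq]

theorem b_eq (M : TorusModel f S) : f b = M.x 1 * f a := by
  rw [M.x_one]; simp [root]

/-- The lift of the unit `1`, with the defect of the relation `b³ = a²`. -/
theorem lift_one (M : TorusModel f S) (h : NormalizedLift A f) :
    ∃ κ ∈ A, M.Lift 1 (κ * 1) ∧ f b ^ 3 = κ * f a ^ 2 := by
  obtain ⟨κ, hκ, e⟩ := h.exists_eq_mul .b_cube
  rw [map_pow, map_pow] at e
  refine ⟨κ, hκ, ?_, e⟩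
  have h1 := WeylSystem.Lift.of_cube (W := M.toWeylSystem) (h := 1) (v := 1) (c := κ)
    (by simpa using WeylSystem.Torus.one) (h.central hκ) ?_
  · simpa using h1
  · have hc : Commute (f b) (f a ^ 2)⁻¹ := Subgroup.mem_center_iff.1 (inv_mem h.a_sq_mem_center) _
    have e1 : M.x ((1 : Sˣ) : S) * M.a⁻¹ * 1 = f b * (f a ^ 2)⁻¹ := by
      rw [M.b_eq, M.a_eq, Units.val_one]; simp only [pow_two]; group
    rw [e1, hc.mul_pow, e]
    have e2 : (f a ^ 2)⁻¹ ^ 3 = (f a ^ 2)⁻¹ := by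
      rw [inv_pow, ← pow_mul, show 2 * 3 = 4 + 2 by rfl, pow_add, h.a_pow, one_mul]
    rw [e2]; group

theorem cword_eq (M : TorusModel f S) (h : NormalizedLift A f) {I : Finset (Fin r)}
    (hI : I.Nonempty) : f (cword I) = M.x (∏ i ∈ I, M.v i : Sˣ) * (f a)⁻¹ *
      (((List.finRange r).filter fun i => i ∈ I).map fun i => f (u i)).prod := by
  have hζ : (M.ζ : S) ^ (2 * r + 1) = 1 := by
    rw [← Units.val_pow_eq_pow_val, M.ζ_pow, Units.val_one]
  have h1 := WeylSystem.list_prod_x_zpow (W := M.toWeylSystem)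
    (fun t : Fin (2 * r + 1) => (M.ζ : S) ^ (t : ℕ)) (coeffI I) M.a_sq_mem (List.finRange _)
  have e1 : ∀ g : Fin (2 * r + 1) → S, ((List.finRange (2 * r + 1)).map g).sum = ∑ t, g t :=
    fun g => (Fin.sum_univ_def g).symm
  rw [e1, ← Fin.sum_univ_def (coeffI I), sum_coeffI hI, zpow_zero, mul_one,
    ← prod_one_sub_eq _ hζ] at h1
  have e2 : ∏ i ∈ I, (1 - (M.ζ : S) ^ ((i : ℕ) + 1)) = ((∏ i ∈ I, M.v i : Sˣ) : S) := by
    rw [Units.coe_prod]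
    exact Finset.prod_congr rfl fun i _ => (M.v_eq i).symm
  rw [e2] at h1
  rw [cword, map_mul, map_mul, map_inv, map_list_prod, map_list_prod, List.map_map, List.map_map,
    ← h1]
  congr 4
  funext t
  simp [M.bt_eq h]

/-- The lift of the unit `∏ (1 - ζ^i)`, with the defect of the relation `c(I)³ = 1`. -/
theorem lift_prod (M : TorusModel f S) (h : NormalizedLift A f) {I : Finset (Fin r)}
    (hI : I.Nonempty) (hc : ∀ i ∈ I, ∀ j ∈ I, Commute (f (u i)) (f (u j))) :
    f (cword I) ^ 3 ∈ A ∧ M.Lift (∏ i ∈ I, M.v i) (f (cword I) ^ 3 *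
      (((List.finRange r).filter fun i => i ∈ I).map fun i => f (u i)).prod⁻¹) := by
  have h0 : f (cword I) ^ 3 ∈ A := by
    simpa using h.rel _ _ (.c_cube I hI)
  refine ⟨h0, WeylSystem.Lift.of_cube ?_ (h.central h0) ?_⟩
  · have := WeylSystem.Torus.list_prod (W := M.toWeylSystem)
      ((List.finRange r).filter fun i => i ∈ I) M.torus_u
      (fun i hi j hj => hc i (by simpa using hi) j (by simpa using hj))
    convert this using 1
    rw [← List.prod_toFinset _ ((List.nodup_finRange r).filter _)]
    have e : ((List.finRange r).filter fun i => i ∈ I).toFinset = I := by ext; simp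
    rw [e, Finset.prod_pow, Finset.prod_inv_distrib]
  · rw [M.cword_eq h hI, M.a_eq]

/-- Multiplying a lifted unit by a power of `ζ`. -/
theorem lift_zeta (M : TorusModel f S) {w : Sˣ} {κ s : E} (h : M.Lift w (κ * s))
    (hκ : κ ∈ Subgroup.center E) (n : ℕ) :
    M.Lift (M.ζ ^ n * w) (κ * ((f z)⁻¹ ^ (n * (r + 1)) * s * (f z)⁻¹ ^ (n * (r + 1)))) := by
  -- `r + 1` is half of `1` modulo `2r + 1`, so `ζ^{n(r+1)}` is a square root of `ζ^n`.
  have h1 := (M.torus_z.inv).pow (n * (r + 1))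
  have h2 : (((M.ζ⁻¹ ^ 2)⁻¹) ^ (n * (r + 1)) : Sˣ) = (M.ζ ^ (n * (r + 1))) ^ 2 := by
    rw [← inv_pow, inv_inv, ← pow_mul, ← pow_mul, mul_comm]
  rw [h2] at h1
  refine (h.conj_central hκ h1).congr ?_ rfl
  rw [← pow_mul, show n * (r + 1) * 2 = (2 * r + 1) * n + n by ring, pow_add, pow_mul, M.ζ_pow,
    one_pow, one_mul]

/-- The symmetry of `1 + (-ζ^i) = 1-ζ^i`: up to constants, the three units lift to `1`, `z^{-i}` and
`u_i⁻¹`. -/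
theorem commute_u_z_pow (M : TorusModel f S) (h : NormalizedLift A f) (i : Fin r) :
    Commute (f (u i)) (f z ^ ((i : ℕ) + 1)) := by
  obtain ⟨κ, hκ, hκ1, -⟩ := M.lift_one h
  obtain ⟨hl, hl1⟩ := M.lift_prod h (Finset.singleton_nonempty i)
    (by simp only [Finset.mem_singleton]; rintro _ rfl _ rfl; exact Commute.refl _)
  have hq := M.lift_zeta hκ1 (h.central hκ) ((i : ℕ) + 1)
  set g := (f z)⁻¹ ^ (((i : ℕ) + 1) * (r + 1)) with hg
  have hinv : g * 1 * g * M.a * (g * 1 * g) = M.a := by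
    have := (M.torus_z.inv).pow (((i : ℕ) + 1) * (r + 1))
    have h2 := WeylSystem.inverted_mul this.inverted this.inverted (Commute.refl _)
    rw [mul_one]; exact h2
  have hq' := hq.neg_central (h.central hκ) hinv
  have hfilter : ((List.finRange r).filter fun j => j ∈ ({i} : Finset (Fin r))) = [i] := by
    have h1 := List.filter_beq i (l := List.finRange r)
    rw [List.count_eq_one_of_mem (List.nodup_finRange r) (List.mem_finRange i),
      List.replicate_one] at h1
    rw [← h1]
    exact List.filter_congr fun j _ => Bool.eq_iff_iff.2 (by simp)
  rw [hfilter] at hl1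
  have hsw := hκ1.swap_central hq' hl1 (h.central hκ)
    (mul_mem (inv_mem (h.central hκ)) M.a_sq) (h.central hl) (by
      rw [Finset.prod_singleton, M.v_eq]; push_cast; ring)
  have hg2 : (g * 1 * g)⁻¹ = f z ^ ((i : ℕ) + 1) := by
    rw [mul_one, ← pow_add, inv_pow, inv_inv,
      show ((i : ℕ) + 1) * (r + 1) + ((i : ℕ) + 1) * (r + 1) =
        (2 * r + 1) * ((i : ℕ) + 1) + ((i : ℕ) + 1) by ring, pow_add, pow_mul, h.z_pow, one_pow,
      one_mul]
  rw [hg2] at hsw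
  have hsw' : Commute (f (u i))⁻¹ (f z ^ ((i : ℕ) + 1)) := by
    simpa [Commute, SemiconjBy] using hsw
  simpa using hsw'.inv_left

theorem commute_u_z (M : TorusModel f S) (h : NormalizedLift A f) (i : Fin r)
    (hi : Nat.Coprime ((i : ℕ) + 1) (2 * r + 1)) : Commute (f (u i)) (f z) := by
  have hr : 1 < 2 * r + 1 := by have := i.2; omega
  obtain ⟨n, -, hn⟩ := Nat.exists_mul_mod_eq_one_of_coprime hi hr
  have h1 := (M.commute_u_z_pow h i).pow_right n
  rwa [← pow_mul, pow_eq_pow_mod _ h.z_pow, hn, pow_one] at h1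

end TorusModel
end SE2

/-! ### The case `ℓ = 5`: commutation of `u₁` and `u₂`. -/

namespace SE2

/-- The monomial `z^i u^j v^k`. -/
def monomial {E : Type*} [Group E] (z u v : E) (i j k : ℤ) : E := z ^ i * u ^ j * v ^ k

theorem monomial_mul {E : Type*} [Group E] {z u v : E} (hzu : Commute u z) (hzv : Commute v z)
    (huv : Commute u v) (i j k i' j' k' : ℤ) :
    monomial z u v i j k * monomial z u v i' j' k' =
      monomial z u v (i + i') (j + j') (k + k') := by
  have h1 := (hzu.zpow_zpow j i').eq
  have h2 := (hzv.zpow_zpow k i').eq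
  have h3 := (huv.zpow_zpow j' k).eq
  simp only [monomial, zpow_add]
  calc _ = z ^ i * u ^ j * (v ^ k * z ^ i') * u ^ j' * v ^ k' := by group
    _ = z ^ i * (u ^ j * z ^ i') * (v ^ k * u ^ j') * v ^ k' := by rw [h2]; group
    _ = _ := by rw [h1, ← h3]; group

theorem monomial_inv {E : Type*} [Group E] {z u v : E} (hzu : Commute u z) (hzv : Commute v z)
    (huv : Commute u v) (i j k : ℤ) :
    (monomial z u v i j k)⁻¹ = monomial z u v (-i) (-j) (-k) := by
  rw [inv_eq_iff_mul_eq_one, monomial_mul hzu hzv huv]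
  simp [monomial]

variable {E S : Type*} [Group E] [CommRing S] {A : Subgroup E} {f : F 2 →* E}

namespace TorusModel

theorem cyclotomic (M : TorusModel f S) :
    1 + (M.ζ : S) + (M.ζ : S) ^ 2 + (M.ζ : S) ^ 3 + (M.ζ : S) ^ 4 = 0 := by
  have h1 := congrArg Units.val M.ζ_pow
  rw [Units.val_pow_eq_pow_val, Units.val_one] at h1
  have h2 := M.v_eq 0
  rw [← Units.mul_right_inj (M.v 0), h2]
  simp only [Fin.val_zero, zero_add]
  linear_combination -h1

theorem v_zero (M : TorusModel f S) : (M.v 0 : S) = 1 - M.ζ := by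
  simpa using M.v_eq 0

theorem v_one (M : TorusModel f S) : (M.v 1 : S) = 1 - (M.ζ : S) ^ 2 := by
  simpa using M.v_eq 1

theorem commute_u_z' (M : TorusModel f S) (h : NormalizedLift A f) (i : Fin 2) :
    Commute (f (u i)) (f z) :=
  M.commute_u_z h i (by fin_cases i <;> decide)

/-- Conjugation by `p` and by `p⁻¹` changes `q⁻²` by `c⁻²` and `c²` respectively. The hypothesis
equates these, so `c⁴ = 1`, and `c⁵ = 1` leaves `c = 1`. -/
theorem commute_of_conj_sq {p q c : E} (hc : ∀ g, g * c = c * g) (hc5 : c ^ 5 = 1)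
    (hpq : p * q = c * (q * p))
    (h : p * q⁻¹ * q⁻¹ * p⁻¹ * (q * q) = q * q * (p⁻¹ * q⁻¹ * q⁻¹ * p)) : Commute p q := by
  have e1 : p * q⁻¹ * q⁻¹ * p⁻¹ = (q⁻¹ * c⁻¹) * (q⁻¹ * c⁻¹) := by
    have : p * q⁻¹ * p⁻¹ = q⁻¹ * c⁻¹ := by
      rw [mul_inv_eq_iff_eq_mul, mul_inv_eq_iff_eq_mul]
      calc p = q⁻¹ * c⁻¹ * (c * (q * p)) := by group
        _ = _ := by rw [← hpq]; group
    rw [← this]; group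
  have e2 : p⁻¹ * q⁻¹ * q⁻¹ * p = (c * q⁻¹) * (c * q⁻¹) := by
    have : p⁻¹ * q⁻¹ * p = c * q⁻¹ := by
      calc p⁻¹ * q⁻¹ * p = p⁻¹ * q⁻¹ * (p * q) * q⁻¹ := by group
        _ = _ := by rw [hpq, ← hc]; group
    rw [← this]; group
  have hci : ∀ g, g * c⁻¹ = c⁻¹ * g := fun g => (Commute.inv_right (hc g) : Commute g c⁻¹)
  rw [e1, e2] at h
  have l1 : q⁻¹ * c⁻¹ * (q⁻¹ * c⁻¹) * (q * q) = c⁻¹ * c⁻¹ := by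
    rw [hci q⁻¹]
    calc _ = c⁻¹ * (q⁻¹ * c⁻¹) * q := by group
      _ = c⁻¹ * c⁻¹ := by rw [hci q⁻¹]; group
  have l2 : q * q * (c * q⁻¹ * (c * q⁻¹)) = c * c := by
    rw [← hc q⁻¹]
    calc _ = q * c * q⁻¹ * c := by group
      _ = _ := by rw [hc q]; group
  rw [l1, l2] at h
  have h1 : c ^ 4 = 1 := by
    calc c ^ 4 = (c * c) * (c * c) := by simp only [pow_succ, pow_zero, one_mul, mul_assoc]
      _ = 1 := by rw [← h]; nth_rw 1 [h]; group
  have h2 : c = 1 := by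
    rw [pow_succ, h1, one_mul] at hc5
    exact hc5
  rw [h2, one_mul] at hpq
  exact hpq

theorem cancel_of_commute {P Q R Y Z : E} (hYP : Commute Y P) (hYQ : Commute Y Q)
    (hYR : Commute Y R) (hZP : Commute Z P) (hZQ : Commute Z Q) (hZR : Commute Z R)
    (hYZ : Commute Y Z)
    (h : P⁻¹ * (Y * R * Y) * (Z * Q * Z)⁻¹ = (Z * Q * Z)⁻¹ * (Y * R * Y) * P⁻¹) :
    P⁻¹ * R * Q⁻¹ = Q⁻¹ * R * P⁻¹ := by
  set y := Y * Y with hy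
  set w := Z⁻¹ * Z⁻¹ with hw
  have e1 : Y * R * Y = R * y := by rw [hYR.eq, mul_assoc]
  have e2 : (Z * Q * Z)⁻¹ = Q⁻¹ * w := by
    rw [mul_inv_rev, mul_inv_rev, ← mul_assoc, hZQ.inv_inv.eq, hw, mul_assoc]
  have c1 : y * Q⁻¹ = Q⁻¹ * y := (hYQ.mul_left hYQ).inv_right.eq
  have c2 : w * R = R * w := (hZR.inv_left.mul_left hZR.inv_left).eq
  have c3 : y * P⁻¹ = P⁻¹ * y := (hYP.mul_left hYP).inv_right.eq
  have c4 : w * P⁻¹ = P⁻¹ * w := (hZP.inv_inv.mul_left hZP.inv_inv).eq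
  have c5 : w * y = y * w := by
    have : Commute y Z⁻¹ := (hYZ.mul_left hYZ).inv_right
    exact (this.mul_right this).symm.eq
  rw [e1, e2] at h
  have l : P⁻¹ * (R * y) * (Q⁻¹ * w) = P⁻¹ * R * Q⁻¹ * (y * w) := by
    calc _ = P⁻¹ * R * (y * Q⁻¹) * w := by simp only [mul_assoc]
      _ = _ := by rw [c1]; simp only [mul_assoc]
  have r : Q⁻¹ * w * (R * y) * P⁻¹ = Q⁻¹ * R * P⁻¹ * (y * w) := by
    calc _ = Q⁻¹ * (w * R) * (y * P⁻¹) := by simp only [mul_assoc]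
      _ = Q⁻¹ * R * (w * P⁻¹) * y := by rw [c2, c3]; simp only [mul_assoc]
      _ = _ := by rw [c4, ← c5]; simp only [mul_assoc]
  rw [l, r] at h
  exact mul_right_cancel h

/-- The elements `u₁` and `u₂` commute, by `(1-ζ)² + ζ⁴(1-ζ²)² = -ζ³(1-ζ)²(1-ζ²)²`. -/
theorem commute_u_zero_u_one (M : TorusModel f S) (h : NormalizedLift A f) :
    Commute (f (u 0)) (f (u 1)) := by
  obtain ⟨κ, hκ, hκ1, -⟩ := M.lift_one h
  have hκc := h.central hκ
  have t0 : M.Torus (f (u 0))⁻¹ ((M.v 0) ^ 2) := by simpa using (M.torus_u 0).inv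
  have t1 : M.Torus (f (u 1))⁻¹ ((M.v 1) ^ 2) := by simpa using (M.torus_u 1).inv
  have tz := fun n : ℕ => (M.torus_z.inv).pow n
  have hp := hκ1.conj_central hκc t0
  have hq0 := hκ1.conj_central hκc t1
  have hq := M.lift_zeta hq0 hκc 4
  have hr0 := M.lift_zeta (hq0.conj_central hκc t0) hκc 3
  have hinv : ∀ {g s : E}, g * M.a * g = M.a → s * M.a * s = M.a →
      g * s * g * M.a * (g * s * g) = M.a := by
    intro g s hg hs
    calc _ = g * (s * (g * M.a * g) * s) * g := by group
      _ = _ := by rw [hg, hs, hg]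
  have hr := hr0.neg_central hκc (hinv (tz _).inverted (hinv t0.inverted (hinv t1.inverted (by simp))))
  -- The identity holds modulo `1 + ζ + ζ² + ζ³ + ζ⁴`; the coefficient below is the polynomial
  -- quotient.
  have hsw := hp.swap_central hq hr hκc hκc (mul_mem (inv_mem hκc) M.a_sq) (by
    push_cast
    rw [M.v_zero, M.v_one]
    linear_combination (1 - 3 * (M.ζ : S) + 3 * (M.ζ : S) ^ 2 - 2 * (M.ζ : S) ^ 4 +
      (M.ζ : S) ^ 5) * M.cyclotomic)
  have cz := fun (n : ℕ) i => ((M.commute_u_z' h i).symm.inv_inv).pow_left n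
  have c1 : ∀ g : E, Commute g 1 := Commute.one_right
  have hfin := cancel_of_commute (((cz _ 0).mul_right (c1 _)).mul_right (cz _ 0))
    (((cz _ 1).mul_right (c1 _)).mul_right (cz _ 1))
    (((cz _ 0).mul_right (((cz _ 1).mul_right (c1 _)).mul_right (cz _ 1))).mul_right (cz _ 0))
    (((cz _ 0).mul_right (c1 _)).mul_right (cz _ 0))
    (((cz _ 1).mul_right (c1 _)).mul_right (cz _ 1))
    (((cz _ 0).mul_right (((cz _ 1).mul_right (c1 _)).mul_right (cz _ 1))).mul_right (cz _ 0))
    (((Commute.refl _).pow_left _).pow_right _) hsw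
  have hA := h.commutator_torusGens (f (u 0)) (Set.mem_insert_of_mem _ ⟨0, rfl⟩) (f (u 1))
    (Set.mem_insert_of_mem _ ⟨1, rfl⟩)
  refine commute_of_conj_sq (h.comm hA) (h.pow_eq_one _ hA)
    (by rw [commutatorElement_def]; group) ?_
  simp only [mul_one, mul_inv_rev, inv_inv, mul_assoc, mul_inv_cancel_left, inv_mul_cancel_left] at hfin ⊢
  exact hfin

end TorusModel
end SE2

/-! ### The case `ℓ = 5`: triviality of the constants. -/

namespace SE2

variable {E S : Type*} [Group E] [CommRing S] {A : Subgroup E} {f : F 2 →* E}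

/-- The monomial `z^i u₁^j u₂^k`. -/
def tor (f : F 2 →* E) (i j k : ℤ) : E := monomial (f z) (f (u 0)) (f (u 1)) i j k

namespace TorusModel

theorem tor_mul (M : TorusModel f S) (h : NormalizedLift A f) (i j k i' j' k' : ℤ) :
    tor f i j k * tor f i' j' k' = tor f (i + i') (j + j') (k + k') :=
  monomial_mul (M.commute_u_z' h 0) (M.commute_u_z' h 1) (M.commute_u_zero_u_one h) ..

theorem tor_inv (M : TorusModel f S) (h : NormalizedLift A f) (i j k : ℤ) :
    (tor f i j k)⁻¹ = tor f (-i) (-j) (-k) :=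
  monomial_inv (M.commute_u_z' h 0) (M.commute_u_z' h 1) (M.commute_u_zero_u_one h) ..

theorem torus_tor (M : TorusModel f S) (h : NormalizedLift A f) (i j k : ℤ) :
    M.Torus (tor f i j k) ((M.ζ ^ i * M.v 0 ^ j * M.v 1 ^ k)⁻¹ ^ 2) := by
  have c0 := M.commute_u_z' h 0
  have c1 := M.commute_u_z' h 1
  have c2 := M.commute_u_zero_u_one h
  have h1 := ((M.torus_z.zpow i).mul ((M.torus_u 0).zpow j) (c0.symm.zpow_zpow _ _)).mul
    ((M.torus_u 1).zpow k) ((c1.symm.zpow_zpow _ _).mul_left (c2.zpow_zpow _ _))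
  have e : ∀ (x : Sˣ) (n : ℤ), (x⁻¹ ^ 2) ^ n = (x ^ n)⁻¹ ^ 2 := fun x n => by
    rw [← inv_zpow, ← zpow_natCast, ← zpow_natCast, zpow_comm]
  rw [e, e, e, ← mul_pow, ← mul_pow, ← mul_inv, ← mul_inv] at h1
  exact h1

/-- Moving a lifted unit by a square. -/
theorem lift_shift (M : TorusModel f S) (h : NormalizedLift A f) {w w' : Sˣ} {κ : E} {i j k : ℤ}
    (hw : M.Lift w (κ * tor f i j k)) (hκ : κ ∈ A) (i' j' k' : ℤ)
    (e : w' * (M.ζ ^ i' * M.v 0 ^ j' * M.v 1 ^ k') ^ 2 = w) :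
    M.Lift w' (κ * tor f (i + 2 * i') (j + 2 * j') (k + 2 * k')) := by
  refine (hw.conj_central (h.central hκ) (M.torus_tor h i' j' k')).congr ?_ ?_
  · rw [← e, inv_pow, mul_comm w', inv_mul_cancel_left]
  · rw [M.tor_mul h, M.tor_mul h]
    congr 2 <;> ring

theorem lift_neg (M : TorusModel f S) (h : NormalizedLift A f) {w : Sˣ} {κ : E} {i j k : ℤ}
    (hw : M.Lift w (κ * tor f i j k)) (hκ : κ ∈ A) :
    M.Lift (-w) (κ⁻¹ * M.a ^ 2 * tor f i j k) :=
  hw.neg_central (h.central hκ) (M.torus_tor h i j k).inverted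

theorem a_mul_tor_mul_a (M : TorusModel f S) (h : NormalizedLift A f) (i j k : ℤ) :
    M.a * tor f i j k * M.a = M.a ^ 2 * tor f (-i) (-j) (-k) := by
  have h1 := WeylSystem.mul_inv_mul_of_inverted (M.torus_tor h (-i) (-j) (-k)).inverted
  rw [M.tor_inv h, neg_neg, neg_neg, neg_neg] at h1
  rw [h1, Subgroup.mem_center_iff.1 M.a_sq]

/-- The relations `1 + ζ = (1-ζ²)/(1-ζ)` and `1 + ζ² = -ζ⁴(1-ζ)/(1-ζ²)` force the constants of the
lifts to be trivial. -/
theorem lift_const_eq_one (M : TorusModel f S) (h : NormalizedLift A f) {y : Sˣ} {κ l : E}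
    {i j k : ℤ} (hκ : κ ∈ A) (hl : l ∈ A) (hy : M.Lift y (κ * tor f i j k))
    (hw : M.Lift (M.v 0 * M.v 1 * y) (l * tor f i (j - 1) (k - 1))) : κ = 1 ∧ l = 1 := by
  have hζ : (M.ζ : S) ^ 5 = 1 := by
    have := M.ζ_pow
    rw [← Units.val_pow_eq_pow_val, this, Units.val_one]
  obtain ⟨Z, hZ⟩ : ∃ Z : S, (M.ζ : S) = Z := ⟨_, rfl⟩
  obtain ⟨V, hV⟩ : ∃ V : S, (M.v 0 : S) = V := ⟨_, rfl⟩
  obtain ⟨W, hW⟩ : ∃ W : S, (M.v 1 : S) = W := ⟨_, rfl⟩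
  obtain ⟨V', hV'⟩ : ∃ V' : S, (((M.v 0)⁻¹ : Sˣ) : S) = V' := ⟨_, rfl⟩
  obtain ⟨W', hW'⟩ : ∃ W' : S, (((M.v 1)⁻¹ : Sˣ) : S) = W' := ⟨_, rfl⟩
  have hv0 := M.v_zero
  have hv1 := M.v_one
  have hi0 := (M.v 0).inv_mul
  have hi1 := (M.v 1).inv_mul
  rw [hV, hZ] at hv0
  rw [hW, hZ] at hv1
  rw [hV', hV] at hi0
  rw [hW', hW] at hi1
  rw [hZ] at hζ
  have hVW : W = (1 + Z) * V := by rw [hv0, hv1]; ring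
  have hWV : (1 + Z ^ 2) * W = -(Z ^ 4 * V) := by
    rw [hv0, hv1]; linear_combination -hζ
  have hκc := h.central hκ
  have hlc := h.central hl
  -- From `y + ζy = (v₁/v₀) y`: here `-pq/r = -ζ (v₀/v₁) y`. Both `(v₁/v₀) y` and `(v₀/v₁) y` differ
  -- from `v₀v₁y` by squares of units, so they carry the constant `l`; the sign inverts it.
  have sq0 : κ⁻¹ * l * κ⁻¹ = l⁻¹ := by
    have hq := M.lift_shift h (w' := M.ζ * y) hy hκ 2 0 0 (by
      apply Units.ext
      push_cast [zpow_ofNat, hZ, hV, hW]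
      linear_combination (y : S) * hζ)
    have hr := M.lift_shift h (w' := (M.v 0)⁻¹ ^ 2 * (M.v 0 * M.v 1 * y)) hw hl 0 1 0 (by
      apply Units.ext
      push_cast [zpow_ofNat, hZ, hV, hW, hV']
      linear_combination (V' * V + 1) * (V * W * y) * hi0)
    have hn := M.lift_neg h (M.lift_shift h
      (w' := M.ζ * (M.v 1)⁻¹ ^ 2 * (M.v 0 * M.v 1 * y)) hw hl 2 0 1 (by
        apply Units.ext
        push_cast [zpow_ofNat, hZ, hV, hW, hW']
        linear_combination V * W * y * W' ^ 2 * W ^ 2 * hζ + V * W * y * (W' * W + 1) * hi1)) hl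
    have := hy.eq_of_add hq hr hn hκc hκc hlc (by
      push_cast [hZ, hV, hW, hV']
      linear_combination -(V' * V + 1) * y * (1 + Z) * hi0 - V' ^ 2 * V * y * hVW) (by
      push_cast [hZ, hV, hW, hV', hW']
      linear_combination -(Z * y ^ 2) * (W' ^ 2 * W ^ 2 * (V' * V + 1) * hi0 + (W' * W + 1) * hi1))
    simp only [M.tor_inv h, M.tor_mul h, M.a_mul_tor_mul_a h] at this
    rw [← mul_assoc] at this
    have e : ∀ {i j k i' j' k' : ℤ}, i = i' → j = j' → k = k' → tor f i j k = tor f i' j' k' := by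
      rintro _ _ _ _ _ _ rfl rfl rfl; rfl
    rw [e (i' := i + 2 * 2) (j' := j - 1 + 2 * 0) (k' := k - 1 + 2 * 1) (by ring) (by ring)
      (by ring)] at this
    exact mul_right_cancel (mul_right_cancel this)
  -- From `y + ζ²y = -ζ⁴ (v₀/v₁) y`, where the sign now sits on the sum. With the previous equation,
  -- `κ² = l²` and `κ² = l⁻²`, so `κ⁴ = 1`.
  have sq1 : κ⁻¹ * l⁻¹ * κ⁻¹ = l := by
    have hq := M.lift_shift h (w' := M.ζ ^ 2 * y) hy hκ 4 0 0 (by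
      apply Units.ext
      push_cast [zpow_ofNat, hZ, hV, hW]
      linear_combination (Z ^ 5 + 1) * (y : S) * hζ)
    have hr := M.lift_neg h (M.lift_shift h
      (w' := M.ζ ^ 4 * (M.v 1)⁻¹ ^ 2 * (M.v 0 * M.v 1 * y)) hw hl 3 0 1 (by
        apply Units.ext
        push_cast [zpow_ofNat, hZ, hV, hW, hW']
        linear_combination V * W * y * W' ^ 2 * W ^ 2 * (Z ^ 5 + 1) * hζ +
          V * W * y * (W' * W + 1) * hi1)) hl
    have hn := M.lift_shift h (w' := M.ζ ^ 3 * (M.v 0)⁻¹ ^ 2 * (M.v 0 * M.v 1 * y)) hw hl 1 1 0 (by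
      apply Units.ext
      push_cast [zpow_ofNat, hZ, hV, hW, hV']
      linear_combination V * W * y * V' ^ 2 * V ^ 2 * hζ + V * W * y * (V' * V + 1) * hi0)
    have := hy.eq_of_add hq hr hn hκc hκc (mul_mem (inv_mem hlc) M.a_sq) (by
      push_cast [hZ, hV, hW, hW']
      linear_combination -(y : S) * (1 + Z ^ 2) * (W' * W + 1) * hi1 + W' ^ 2 * W * y * hWV) (by
      push_cast [hZ, hV, hW, hV', hW']
      linear_combination -(Z ^ 2 * y ^ 2) * (V' ^ 2 * V ^ 2 * W' ^ 2 * W ^ 2 * hζ +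
        W' ^ 2 * W ^ 2 * (V' * V + 1) * hi0 + (W' * W + 1) * hi1))
    simp only [M.tor_inv h, M.tor_mul h, M.a_mul_tor_mul_a h] at this
    have e : ∀ {i j k i' j' k' : ℤ}, i = i' → j = j' → k = k' → tor f i j k = tor f i' j' k' := by
      rintro _ _ _ _ _ _ rfl rfl rfl; rfl
    rw [e (i' := i + 2 * 1) (j' := j - 1 + 2 * 1) (k' := k - 1 + 2 * 0) (by ring) (by ring)
      (by ring), ← mul_assoc] at this
    have h2 := mul_right_cancel this
    refine Eq.trans ?_ h2
    have ha : M.a ^ 2 * M.a ^ 2 = 1 := by rw [← pow_add]; exact M.a_pow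
    have hac := Subgroup.mem_center_iff.1 M.a_sq
    calc κ⁻¹ * l⁻¹ * κ⁻¹ = κ⁻¹ * l⁻¹ * κ⁻¹ * (M.a ^ 2 * M.a ^ 2) := by rw [ha, mul_one]
      _ = κ⁻¹ * l⁻¹ * (κ⁻¹ * M.a ^ 2) * M.a ^ 2 := by simp only [mul_assoc]
      _ = _ := by rw [hac κ⁻¹]; simp only [mul_assoc]
  have hκi : ∀ g, g * κ⁻¹ = κ⁻¹ * g := Subgroup.mem_center_iff.1 (inv_mem hκc)
  have h1 : κ = 1 := by
    have : (κ⁻¹ ^ 2) ^ 2 = 1 := by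
      have h3 : l⁻¹ = (κ⁻¹ ^ 2) ^ 2 * l⁻¹ := by
        calc l⁻¹ = κ⁻¹ * (κ⁻¹ * l⁻¹ * κ⁻¹) * κ⁻¹ := by rw [sq1, sq0]
          _ = κ⁻¹ * κ⁻¹ * (l⁻¹ * κ⁻¹) * κ⁻¹ := by group
          _ = κ⁻¹ * κ⁻¹ * κ⁻¹ * l⁻¹ * κ⁻¹ := by rw [hκi l⁻¹]; group
          _ = κ⁻¹ * κ⁻¹ * κ⁻¹ * (l⁻¹ * κ⁻¹) := by group
          _ = _ := by rw [hκi l⁻¹]; group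
      exact (mul_eq_right.1 h3.symm)
    have h2 := h.eq_one_of_sq (pow_mem (A.inv_mem hκ) 2) this
    have h3 := h.eq_one_of_sq (A.inv_mem hκ) h2
    simpa using h3
  refine ⟨h1, h.eq_one_of_sq hl ?_⟩
  rw [h1] at sq0
  rw [pow_two, mul_eq_one_iff_eq_inv]
  simpa using sq0

end TorusModel
end SE2

/-! ### The case `ℓ = 5`: all relations hold exactly. -/

namespace SE2

variable {E S : Type*} [Group E] [CommRing S] {A : Subgroup E} {f : F 2 →* E}

namespace TorusModel

theorem commute_u_u (M : TorusModel f S) (h : NormalizedLift A f) (i j : Fin 2) :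
    Commute (f (u i)) (f (u j)) := by
  have h1 := M.commute_u_zero_u_one h
  fin_cases i <;> fin_cases j
  · exact Commute.refl _
  · exact h1
  · exact h1.symm
  · exact Commute.refl _

/-- `lift_const_eq_one` with `y = 1` treats `b³` and `I = {1,2}`. With `y = v₀` it treats the two
singletons, since `v₀v₁v₀` is `v₁` times a square. -/
theorem cube_relations (M : TorusModel f S) (h : NormalizedLift A f) :
    f b ^ 3 = f a ^ 2 ∧ ∀ I : Finset (Fin 2), I.Nonempty → f (cword I) ^ 3 = 1 := by
  obtain ⟨κ, hκ, hκ1, e⟩ := M.lift_one h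
  have hL := fun (I : Finset (Fin 2)) (hI : I.Nonempty) =>
    M.lift_prod h hI fun i _ j _ => M.commute_u_u h i j
  have hcases : ∀ I : Finset (Fin 2), I.Nonempty → I = {0} ∨ I = {1} ∨ I = Finset.univ := by
    decide
  have hf0 : ((List.finRange 2).filter fun i => i ∈ ({0} : Finset (Fin 2))) = [0] := by decide
  have hf1 : ((List.finRange 2).filter fun i => i ∈ ({1} : Finset (Fin 2))) = [1] := by decide
  have hf2 : ((List.finRange 2).filter fun i => i ∈ (Finset.univ : Finset (Fin 2))) = [0, 1] := by
    decide
  have L0 := hL {0} (by simp)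
  have L1 := hL {1} (by simp)
  have L2 := hL Finset.univ Finset.univ_nonempty
  rw [hf0] at L0
  rw [hf1] at L1
  rw [hf2] at L2
  have hc := M.commute_u_zero_u_one h
  have k1 := M.lift_const_eq_one h (y := 1) (i := 0) (j := 0) (k := 0) hκ L2.1
    (hκ1.congr rfl (by simp [tor, monomial])) (L2.2.congr (by simp [Fin.prod_univ_two])
      (by simp [tor, monomial, hc.inv_inv.eq]))
  have s1 := M.lift_shift h (w := M.v 1) (w' := M.v 0 * M.v 1 * M.v 0) (κ := f (cword {1}) ^ 3)
    (i := 0) (j := 0) (k := -1) (L1.2.congr (by simp) (by simp [tor, monomial])) L1.1 0 (-1) 0 (by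
      apply Units.ext
      simp only [zpow_zero, zpow_neg, zpow_one, one_mul, mul_one, Units.val_mul,
        Units.val_pow_eq_pow_val]
      linear_combination (M.v 1 : S) * ((M.v 0 : S) * ((M.v 0)⁻¹ : Sˣ) + 1) * (M.v 0).mul_inv)
  have k2 := M.lift_const_eq_one h (y := M.v 0) (i := 0) (j := -1) (k := 0) L0.1 L1.1
    (L0.2.congr (by simp) (by simp [tor, monomial]))
    (s1.congr rfl (by norm_num))
  refine ⟨by rw [e, k1.1, one_mul], fun I hI => ?_⟩
  rcases hcases I hI with rfl | rfl | rfl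
  · exact k2.1
  · exact k2.2
  · exact k1.2

theorem a_sq_pow (h : NormalizedLift A f) : (f a ^ 2) ^ (2 * 2 + 1) = f a ^ 2 := by
  rw [← pow_mul, show 2 * (2 * 2 + 1) = 4 * 2 + 2 by rfl, pow_add, pow_mul, h.a_pow, one_pow,
    one_mul]

theorem b_prod (M : TorusModel f S) (h : NormalizedLift A f) :
    f a ^ 2 = ((List.finRange (2 * 2 + 1)).map fun t => f (bt t)).prod := by
  have h1 := WeylSystem.list_prod_x_zpow (W := M.toWeylSystem)
    (fun t : Fin (2 * 2 + 1) => (M.ζ : S) ^ (t : ℕ)) (fun _ => 1) M.a_sq_mem (List.finRange _)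
  rw [← Fin.sum_univ_def, ← Fin.sum_univ_def] at h1
  simp only [zpow_one, ← M.bt_eq h] at h1
  rw [h1]
  have e : (∑ t : Fin (2 * 2 + 1), (((1 : ℤ) : S) * (M.ζ : S) ^ (t : ℕ))) = 0 := by
    rw [← M.cyclotomic]
    simp [Fin.sum_univ_succ]
    ring
  rw [e, M.x_zero, one_mul]
  simpa using (a_sq_pow h).symm

theorem b_pow (M : TorusModel f S) (h : NormalizedLift A f) (t : Fin (2 * 2 + 1)) :
    f (bt t) ^ (2 * 2 + 1) = (f w)⁻¹ * f (bt t) ^ ((-1 : ℤ) ^ 2) * f w := by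
  have hw : f w = tor f (cexp 2) 1 1 := by
    rw [h.w_def]
    simp [tor, monomial, List.finRange_succ, mul_assoc]
  have hc : 2 * cexp 2 ≡ 2 ^ 2 + 2 * (2 + 1) / 2 [MOD 2 * 2 + 1] := Nat.find_spec (exists_cexp 2)
  have hζ : M.ζ ^ (2 * cexp 2) = M.ζ ^ 2 := by
    rw [pow_eq_pow_mod _ M.ζ_pow, hc]
    rfl
  have h1 := (M.torus_tor h (cexp 2) 1 1).inv.conj_x ((M.ζ : S) ^ (t : ℕ))
  -- The choice of `c` gives `ζ^{2c} = ζ²`, and `ζ²(1-ζ)²(1-ζ²)² = 5` by the cyclotomic relation. So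
  -- `w⁻¹` acts on unipotents as the fifth power.
  have e : ((((M.ζ ^ (cexp 2 : ℤ) * M.v 0 ^ (1 : ℤ) * M.v 1 ^ (1 : ℤ))⁻¹ ^ 2)⁻¹ : Sˣ) : S) =
      ((5 : ℤ) : S) := by
    rw [inv_pow, inv_inv, zpow_natCast, zpow_one, zpow_one, mul_pow, mul_pow, ← pow_mul, mul_comm,
      mul_comm (cexp 2), hζ]
    push_cast
    rw [M.v_zero, M.v_one]
    linear_combination (-5 + 5 * (M.ζ : S) + (M.ζ : S) ^ 2 - 3 * (M.ζ : S) ^ 3 +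
      (M.ζ : S) ^ 4) * M.cyclotomic
  rw [e, M.x_zsmul, ← hw, inv_inv] at h1
  have hac := Subgroup.mem_center_iff.1 M.a_sq_mem
  have hcm : Commute (M.x ((M.ζ : S) ^ (t : ℕ))) (f a ^ 2) := hac _
  rw [M.bt_eq h, hcm.mul_pow, a_sq_pow h, show ((-1 : ℤ) ^ 2) = 1 by rfl, zpow_one]
  calc M.x ((M.ζ : S) ^ (t : ℕ)) ^ (2 * 2 + 1) * f a ^ 2 =
        (f w)⁻¹ * M.x ((M.ζ : S) ^ (t : ℕ)) * f w * f a ^ 2 := by rw [h1, zpow_ofNat]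
    _ = (f w)⁻¹ * M.x ((M.ζ : S) ^ (t : ℕ)) * (f w * f a ^ 2) := by group
    _ = _ := by rw [hac]; group

end TorusModel

/-- For `r = 2` an exact lift satisfies all the defining relations. -/
theorem ExactLift.map_eq_of_rel (h : ExactLift A f) (M : TorusModel f S) {x y : F 2}
    (hxy : DefRel 2 x y) : f x = f y := by
  have hN := h.toNormalizedLift
  have ha := Subgroup.mem_center_iff.1 h.a_sq_mem_center
  cases hxy with
  | bt_def t => simpa using h.bt_def t
  | w_def => exact h.w_def
  | z_pow => simpa using h.z_pow
  | z_u i =>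
    rw [map_commutatorElement, map_one, commutatorElement_eq_one_iff_commute]
    exact (M.commute_u_z' hN i).symm
  | u_u i j =>
    rw [map_commutatorElement, map_one, commutatorElement_eq_one_iff_commute]
    exact M.commute_u_u hN i j
  | a_pow => simpa using h.a_pow
  | a_z =>
    rw [map_commutatorElement, map_one, commutatorElement_eq_one_iff_commute, map_pow]
    exact (ha _).symm
  | a_u i =>
    rw [map_commutatorElement, map_one, commutatorElement_eq_one_iff_commute, map_pow]
    exact (ha _).symm
  | z_a_z => simpa using h.z_a_z.symm
  | u_a_u i => simpa using (h.u_a_u i).symm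
  | b_b s t =>
    rw [map_commutatorElement, map_one, commutatorElement_eq_one_iff_commute]
    exact h.bt_commute s t
  | b_cube => simpa using (M.cube_relations hN).1
  | b_prod =>
    rw [map_list_prod, List.map_map, map_pow]
    exact M.b_prod hN
  | b_pow t => simpa using M.b_pow hN t
  | c_cube I hI => simpa using (M.cube_relations hN).2 I hI
  | last i =>
    obtain ⟨α, hα, e⟩ := h.exists_eq_mul (.last i)
    -- The error `α` of this relation is the defect of the conjugation formula, which vanishes for
    -- an exact lift.
    have h1 := h.u_conj_root_zero_of_last i hα e
    rw [h.conj_root] at h1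
    rw [e, left_eq_mul.1 h1, one_mul]

end SE2

/-! ### The extension `F/[F,K]K^ℓ` and the conclusion. -/

namespace SE2

instance (r n : ℕ) : (FKKpow r n).Normal := by
  have h1 : (K r).Normal := Subgroup.normalClosure_normal
  have h2 : (Kpow r n).Normal := Subgroup.normalClosure_normal
  unfold FKKpow
  infer_instance

/-- The quotient by `[F,K]K^ℓ` is a central extension of `F/K` by a group of exponent `ℓ`. -/
theorem centralLift_mk (r : ℕ) :
    CentralLift ((K r).map (QuotientGroup.mk' (FKKpow r (2 * r + 1))))
      (QuotientGroup.mk' (FKKpow r (2 * r + 1))) where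
  central := by
    rintro _ ⟨k, hk, rfl⟩
    rw [Subgroup.mem_center_iff]
    intro g
    obtain ⟨g, rfl⟩ := QuotientGroup.mk'_surjective _ g
    change Commute _ _
    rw [← commutatorElement_eq_one_iff_commute, ← map_commutatorElement]
    exact (QuotientGroup.eq_one_iff _).2
      (Subgroup.mem_sup_left (Subgroup.commutator_mem_commutator (Subgroup.mem_top g) hk))
  pow_eq_one := by
    rintro _ ⟨k, hk, rfl⟩
    rw [← map_pow]
    refine (QuotientGroup.eq_one_iff _).2 ?_
    change k ∈ Subgroup.closure _ at hk
    induction hk using Subgroup.closure_induction with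
    | mem k hk =>
      obtain ⟨g, hg, hgk⟩ := Group.mem_conjugatesOfSet_iff.1 hk
      obtain ⟨c, rfl⟩ := isConj_iff.1 hgk
      rw [conj_pow]
      have hmem : g ^ (2 * r + 1) ∈ Kpow r (2 * r + 1) :=
        Subgroup.subset_normalClosure (Set.mem_image_of_mem (fun g => g ^ (2 * r + 1)) hg)
      exact Subgroup.mem_sup_right (Subgroup.normalClosure_normal.conj_mem _ hmem c)
    | one => rw [one_pow]; exact one_mem _
    | mul x y hx hy h h' =>
      rw [← QuotientGroup.eq_one_iff] at h h' ⊢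
      have hc : Commute (x : F r ⧸ FKKpow r (2 * r + 1)) y := by
        rw [← commutatorElement_eq_one_iff_commute]
        exact (QuotientGroup.eq_one_iff _).2 (Subgroup.mem_sup_left
          (Subgroup.commutator_mem_commutator (Subgroup.mem_top x) hy))
      rw [QuotientGroup.mk_pow] at h h' ⊢
      rw [QuotientGroup.mk_mul, hc.mul_pow, h, h', one_mul]
    | inv x hx h => rw [inv_pow]; exact inv_mem h
  rel x y hxy := by
    rw [← map_inv, ← map_mul]
    exact ⟨_, Subgroup.subset_normalClosure ⟨x, y, hxy, rfl⟩, rfl⟩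
  mem_center c hc := by
    rw [Subgroup.mem_center_iff]
    intro g
    obtain ⟨g, rfl⟩ := QuotientGroup.mk'_surjective _ g
    change Commute _ _
    induction g using FreeGroup.induction_on with
    | C1 => rw [map_one]; exact Commute.one_left c
    | of i => exact (hc i).symm
    | inv_of i h => rw [map_inv]; exact h.inv_left
    | mul x y hx hy => rw [map_mul]; exact hx.mul_left hy

/-- The projection to the quotient agrees on commutators with an exact lift. -/
theorem exists_exact_lift (r : ℕ) :
    ∃ (S : Type) (_ : CommRing S) (f : F r →* F r ⧸ FKKpow r (2 * r + 1)),
      ExactLift ((K r).map (QuotientGroup.mk' (FKKpow r (2 * r + 1)))) f ∧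
      Nonempty (TorusModel f S) ∧
      ∀ g k : F r, f ⁅g, k⁆ = QuotientGroup.mk' (FKKpow r (2 * r + 1)) ⁅g, k⁆ := by
  have h₀ := centralLift_mk r
  obtain ⟨f₁, h₁, e₁⟩ := h₀.exists_normalized
  obtain ⟨f₂, h₂, e₂⟩ := h₁.exists_exact
  obtain ⟨S, hS, hM⟩ := h₂.exists_model
  exact ⟨S, hS, f₂, h₂, hM, fun g k =>
    (h₁.commutator_eq e₂ g k).trans (h₀.commutator_eq e₁ g k)⟩

theorem commutator_mem_FKKpow {r : ℕ} (hr : r = 1 ∨ r = 2) {e₁ e₂ : F r}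
    (h₁ : e₁ ∈ insert SE2.z (Set.range (SE2.u (r := r))))
    (h₂ : e₂ ∈ insert SE2.z (Set.range (SE2.u (r := r)))) :
    ⁅e₁, e₂⁆ ∈ FKKpow r (2 * r + 1) := by
  obtain ⟨S, _, f, h, ⟨M⟩, hf⟩ := exists_exact_lift r
  rw [← QuotientGroup.eq_one_iff]
  refine (hf e₁ e₂).symm.trans ?_
  rw [map_commutatorElement, commutatorElement_eq_one_iff_commute]
  have hz : ∀ i, Commute (f (u i)) (f z) := by
    intro i
    refine M.commute_u_z h.toNormalizedLift i ?_
    rcases hr with rfl | rfl <;> fin_cases i <;> decide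
  have hu : ∀ i j, Commute (f (u i)) (f (u j)) := by
    intro i j
    rcases hr with rfl | rfl
    · rw [Subsingleton.elim i j]
    · exact M.commute_u_u h.toNormalizedLift i j
  rcases h₁ with rfl | ⟨i, rfl⟩ <;> rcases h₂ with rfl | ⟨j, rfl⟩
  · exact Commute.refl _
  · exact (hz j).symm
  · exact hz i
  · exact hu i j

theorem commutator_inf_K_le : ⁅(⊤ : Subgroup (F 2)), (⊤ : Subgroup (F 2))⁆ ⊓ K 2 ≤ FKKpow 2 5 := by
  obtain ⟨S, _, f, h, ⟨M⟩, hf⟩ := exists_exact_lift 2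
  have hK : K 2 ≤ f.ker := Subgroup.normalClosure_le_normal (by
    rintro _ ⟨x, y, hxy, rfl⟩
    rw [SetLike.mem_coe, MonoidHom.mem_ker, map_mul, map_inv, h.map_eq_of_rel M hxy,
      mul_inv_cancel])
  have hcomm : ⁅(⊤ : Subgroup (F 2)), (⊤ : Subgroup (F 2))⁆ ≤
      f.eqLocus (QuotientGroup.mk' (FKKpow 2 (2 * 2 + 1))) :=
    Subgroup.commutator_le.2 fun g _ k _ => hf g k
  rintro g ⟨hg, hgK⟩
  have h1 : f g = QuotientGroup.mk' (FKKpow 2 (2 * 2 + 1)) g := hcomm hg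
  rw [hK hgK] at h1
  exact (QuotientGroup.eq_one_iff g).1 h1.symm

end SE2

theorem proposition7p3 :
    (∀ ℓ r : ℕ, ℓ = 2 * r + 1 → ℓ ∈ ({3, 5} : Set ℕ) →
      ∀ e₁ ∈ insert SE2.z (Set.range (SE2.u (r := r))),
      ∀ e₂ ∈ insert SE2.z (Set.range (SE2.u (r := r))),
        ⁅e₁, e₂⁆ ∈ SE2.FKKpow r ℓ) ∧
    ⁅(⊤ : Subgroup (SE2.F 2)), (⊤ : Subgroup (SE2.F 2))⁆ ⊓ SE2.K 2 ≤ SE2.FKKpow 2 5 := by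
  refine ⟨?_, SE2.commutator_inf_K_le⟩
  rintro ℓ r rfl hℓ e₁ h₁ e₂ h₂
  refine SE2.commutator_mem_FKKpow ?_ h₁ h₂
  simp only [Set.mem_insert_iff, Set.mem_singleton_iff] at hℓ
  omega
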